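/- Let $d\ge 2$ and let $\mathrm{Poly}_d$ be the space of complex polynomials of degree exactly $d$, identified through coefficients with the open subset $\{b_d\neq 0\}$ of $\mathbb{C}^{d+1}$, so that $T_P\mathrm{Poly}_d=\mathbb{C}^{d+1}$. Let $P\in\mathrm{Poly}_d$ be a hyperbolic, postcritically finite polynomial all of whose critical points (in $\mathbb{C}$) are simple (i.e. $P''\neq0$ there) and periodic. Here $P$ is postcritically finite if the union of the strict forward orbits of its critical points is finite, and hyperbolic if every critical point eventually lands in the basin of attraction of an attracting (or super-attracting) cycle. Let $\mathcal{O}(P)=\{\varphi^{-1}\circ P\circ\varphi : \varphi(z)=\alpha z+\beta,\ \alpha\in\mathbb{C}^*,\ \beta\in\mathbb{C}\}\subset \mathrm{Poly}_d$ be the affine conjugacy orbit of $P$, and $T_P\mathcal{O}(P)$ its tangent space at $P$, i.e. the set of velocities at $P$ of holomorphic curves through $P$ contained in $\mathcal{O}(P)$. Then there exist an open neighbourhood $V\subset\mathrm{Poly}_d$ of $P$ and holomorphic functions $c_0,\dots,c_{d-2}:V\to\mathbb{C}$ such that $\{c_0(Q),\dots,c_{d-2}(Q)\}$ is the set of critical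 points of $Q$ for every $Q\in V$. Moreover, for every such choice of $V$ and $c_0,\dots,c_{d-2}$, and for all integers $m_0,\dots,m_{d-2}\ge 1$ with $P^{m_i}(c_i(P))=c_i(P)$ for each $i$, define $\mathfrak{c},\mathfrak{m}:V\to\mathbb{C}^{d-1}$ by $$\mathfrak{c}(Q)=(c_0(Q),\dots,c_{d-2}(Q)),\qquad \mathfrak{m}(Q)=\bigl(Q^{m_0}(c_0(Q)),\dots,Q^{m_{d-2}}(c_{d-2}(Q))\bigr),$$ where $Q^{m}$ denotes the $m$-th iterate. Then $$\ker(D_P\mathfrak{c}-D_P\mathfrak{m})=T_P\mathcal{O}(P).$$ Furthermore the $d-1$ local hypersurfaces $H_i=\{Q\in V : Q^{m_i}(c_i(Q))=c_i(Q)\}$, $0\le i\le d-2$, are smooth at $P$ and transverse at $P$: near $P$ each $H_i$ is the zero set of a holomorphic function with nonzero differential at $P$, the intersection of the tangent spaces $T_PH_i$ has codimension $d-1$ in $\mathbb{C}^{d+1}$, and the differentials at $P$ of the defining functions $Q\mapsto Q^{m_i}(c_i(Q))-c_i(Q)$ are linearly independent. -/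

import Mathlib

open Polynomial Filter Topology

namespace PolyTrans

noncomputable section

/-- The polynomial `b₀ + b₁ z + ⋯ + b_d z ^ d` with coefficient vector `b`. -/
def toPoly {d : ℕ} (b : Fin (d + 1) → ℂ) : ℂ[X] :=
  ∑ i : Fin (d + 1), C (b i) * X ^ (i : ℕ)

/-- The space of complex polynomials of degree exactly `d`, as the open subset `b_d ≠ 0` of the
space `ℂ^(d+1)` of coefficient vectors. Its tangent space at each point is `ℂ^(d+1)`. -/
def PolyD (d : ℕ) : Set (Fin (d + 1) → ℂ) :=
  {b | b (Fin.last d) ≠ 0}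

/-- The self-map of the complex plane given by the polynomial with coefficient vector `b`. -/
def dyn {d : ℕ} (b : Fin (d + 1) → ℂ) : ℂ → ℂ :=
  fun z => (toPoly b).eval z

/-- The set of critical points in the plane. -/
def critSet {d : ℕ} (b : Fin (d + 1) → ℂ) : Set ℂ :=
  {z | (derivative (toPoly b)).eval z = 0}

/-- The postcritical set: all strict forward iterates of the critical points. -/
def postcritSet {d : ℕ} (b : Fin (d + 1) → ℂ) : Set ℂ :=
  ⋃ n : ℕ, ⋃ _ : 1 ≤ n, (dyn b)^[n] '' critSet b

def IsPostcriticallyFinite {d : ℕ} (b : Fin (d + 1) → ℂ) : Prop :=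
  (postcritSet b).Finite

/-- `p` lies on an attracting (or super-attracting) cycle of `f`, whose period divides `k`. -/
def IsAttractingPeriodicPt (f : ℂ → ℂ) (k : ℕ) (p : ℂ) : Prop :=
  0 < k ∧ Function.IsPeriodicPt f k p ∧ ‖deriv f^[k] p‖ < 1

/-- The basin of attraction of the cycle of a point `p` fixed by `f^[k]`. -/
def basin (f : ℂ → ℂ) (k : ℕ) (p : ℂ) : Set ℂ :=
  {z | ∃ j : ℕ, Tendsto (fun n : ℕ => f^[n * k] z) atTop (𝓝 (f^[j] p))}

/-- Hyperbolicity: each critical point eventually lands in the basin of attraction of an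
attracting (or super-attracting) cycle. -/
def IsHyperbolic {d : ℕ} (b : Fin (d + 1) → ℂ) : Prop :=
  ∀ c ∈ critSet b, ∃ (k : ℕ) (p : ℂ), IsAttractingPeriodicPt (dyn b) k p ∧
    ∃ n : ℕ, (dyn b)^[n] c ∈ basin (dyn b) k p

/-- All critical points are simple: the second derivative does not vanish there. -/
def HasSimpleCritPts {d : ℕ} (b : Fin (d + 1) → ℂ) : Prop :=
  ∀ c ∈ critSet b, (derivative (derivative (toPoly b))).eval c ≠ 0

/-- All critical points are periodic. -/
def HasPeriodicCritPts {d : ℕ} (b : Fin (d + 1) → ℂ) : Prop :=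
  ∀ c ∈ critSet b, c ∈ Function.periodicPts (dyn b)

/-- The orbit of `P` under conjugacy by affine maps `φ z = α z + β` with `α ≠ 0`:
all `Q` of degree `d` with `φ ∘ Q = P ∘ φ`, that is, `Q = φ⁻¹ ∘ P ∘ φ`. -/
def affineOrbit {d : ℕ} (P : Fin (d + 1) → ℂ) : Set (Fin (d + 1) → ℂ) :=
  {Q | Q ∈ PolyD d ∧ ∃ α β : ℂ, α ≠ 0 ∧ ∀ z : ℂ, α * dyn Q z + β = dyn P (α * z + β)}

/-- `c i`, for `i = 0, …, d - 2`, are holomorphic functions on an open neighbourhood `V` of `P`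
in the space of polynomials of degree `d`, and they mark all critical points. -/
structure IsCritMarking {d : ℕ} (P : Fin (d + 1) → ℂ) (V : Set (Fin (d + 1) → ℂ))
    (c : Fin (d - 1) → (Fin (d + 1) → ℂ) → ℂ) : Prop where
  isOpen : IsOpen V
  mem : P ∈ V
  subset : V ⊆ PolyD d
  holo : ∀ i, DifferentiableOn ℂ (c i) V
  range_eq : ∀ Q ∈ V, Set.range (fun i => c i Q) = critSet Q

/-- The map `Q ↦ (c₀(Q), …, c_{d-2}(Q))`. -/
def critMap {d : ℕ} (c : Fin (d - 1) → (Fin (d + 1) → ℂ) → ℂ) :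
    (Fin (d + 1) → ℂ) → (Fin (d - 1) → ℂ) :=
  fun Q i => c i Q

/-- The map `Q ↦ (Q^{m₀}(c₀(Q)), …, Q^{m_{d-2}}(c_{d-2}(Q)))`. -/
def iterMap {d : ℕ} (c : Fin (d - 1) → (Fin (d + 1) → ℂ) → ℂ) (m : Fin (d - 1) → ℕ) :
    (Fin (d + 1) → ℂ) → (Fin (d - 1) → ℂ) :=
  fun Q i => (dyn Q)^[m i] (c i Q)

/-- The local hypersurface `{Q ∈ V : Q^{m_i}(c_i(Q)) = c_i(Q)}`. -/
def perHypersurface {d : ℕ} (V : Set (Fin (d + 1) → ℂ))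
    (c : Fin (d - 1) → (Fin (d + 1) → ℂ) → ℂ) (m : Fin (d - 1) → ℕ) (i : Fin (d - 1)) :
    Set (Fin (d + 1) → ℂ) :=
  {Q | Q ∈ V ∧ (dyn Q)^[m i] (c i Q) = c i Q}

section Geometry

variable {E : Type*} [NormedAddCommGroup E] [NormedSpace ℂ E]

/-- The velocities at time `0` of the germs of holomorphic curves through `x` contained in `S`.
If `S` is a complex submanifold, this is its tangent space at `x`. -/
def tangentVectors (S : Set E) (x : E) : Set E :=
  {v | ∃ γ : ℂ → E, ∃ r > 0, DifferentiableOn ℂ γ (Metric.ball 0 r) ∧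
    (∀ t ∈ Metric.ball (0 : ℂ) r, γ t ∈ S) ∧ γ 0 = x ∧ deriv γ 0 = v}

/-- Near its point `x`, the set `S` is a smooth complex hypersurface: it is the zero set of a
holomorphic function whose differential at `x` is not zero. -/
def IsSmoothHypersurfaceAt (S : Set E) (x : E) : Prop :=
  x ∈ S ∧ ∃ (U : Set E) (g : E → ℂ), IsOpen U ∧ x ∈ U ∧ DifferentiableOn ℂ g U ∧
    fderiv ℂ g x ≠ 0 ∧ S ∩ U = {y | y ∈ U ∧ g y = 0}

/-- A finite family of hypersurfaces is transverse at `x`: the tangent spaces at `x` are linear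
subspaces whose intersection has codimension the number of hypersurfaces. -/
def IsTransverseAt {ι : Type*} [Fintype ι] (S : ι → Set E) (x : E) : Prop :=
  ∃ T : ι → Submodule ℂ E, (∀ i, (T i : Set E) = tangentVectors (S i) x) ∧
    Module.finrank ℂ (⨅ i, T i : Submodule ℂ E) + Fintype.card ι = Module.finrank ℂ E

end Geometry

end

end PolyTrans

/-! The crux is that the differentials at `P` of G_i(Q) = Q^{m_i}(c_i(Q)) - c_i(Q) are linearly
independent; the method is Thurston's contraction principle for quadratic differentials.

Write p for `P`, c_i for c_i(P), x_k for p^k(c_i) and w_k for the derivative of p^{m_i-k} at x_k.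
The chain rule, together with p'(c_i) = 0, gives dG_i(v) = v'(c_i)/p''(c_i) + Σ_{k<m_i} w_{k+1}
v(x_k), which is `critVariation`. To a relation Σ l_i dG_i = 0 attach the rational function q(z) =
Σ_i l_i Σ_{k<m_i} w_{k+1}/(z - x_{k+1}), viewed as the quadratic differential q dz². Let L be the
combination Σ l_i `critVariation`, extended to functions with poles off the orbits. Testing the
relation on the polynomial (p'(z) - p'(u))/(z - u) yields q(u) = -p'(u) L(1/(z-u)), while L(1/(p-y))
= -q(y). The partial fractions 1/(p-y) = Σ_{p(u)=y} 1/(p'(u)(z-u)) then turn into p_*q = q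
(`transfer_eq_of_critVariation`).

Push-forward does not increase mass. On a large disc B with p⁻¹(B) inside B, the fixed q must have
no mass on B \ p⁻¹(B), so it vanishes there, hence everywhere off its poles (`eq_zero_of_transfer`).
Its residue at c_j is l_j, so every l_j is zero (`eq_zero_of_critVariation`).

Independence gives smoothness and transversality by the implicit function theorem, and a common
kernel of dimension two. That kernel contains the tangent vectors of the affine orbit, because
periodicity of critical points is invariant under conjugacy; these already include two independent
vectors, so the two sets agree. -/

namespace PolyTrans

/-! ### Push-forward of quadratic differentials and contraction of mass. -/

open MeasureTheory ENNReal

/-- The plane minus the critical points of `p` is a countable disjoint union of measurable sets on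
which `p` is injective. -/
theorem exists_injOn_partition (p : ℂ[X]) :
    ∃ A : ℕ → Set ℂ, (∀ n, MeasurableSet (A n)) ∧ Pairwise (Function.onFun Disjoint A) ∧
      (∀ n, Set.InjOn (fun z => p.eval z) (A n)) ∧
      ∀ z, (derivative p).eval z ≠ 0 → ∃ n, z ∈ A n := by
  classical
  have key : ∀ z : ℂ, ∃ O : Set ℂ, IsOpen O ∧ Set.InjOn (fun z => p.eval z) O ∧
      ((derivative p).eval z ≠ 0 → z ∈ O) := by
    intro z
    by_cases hz : (derivative p).eval z = 0
    -- The empty set at critical points makes the family total; elsewhere the inverse function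
    -- theorem applies.
    · exact ⟨∅, isOpen_empty, Set.injOn_empty _, fun h => (h hz).elim⟩
    have h1 : HasStrictFDerivAt (fun z => p.eval z)
        ((ContinuousLinearEquiv.unitsEquivAut ℂ (Units.mk0 _ hz) : ℂ ≃L[ℂ] ℂ) : ℂ →L[ℂ] ℂ) z :=
      (p.hasStrictDerivAt z).hasStrictFDerivAt_equiv hz
    refine ⟨(h1.toOpenPartialHomeomorph _).source, (h1.toOpenPartialHomeomorph _).open_source, ?_,
      fun _ => h1.mem_toOpenPartialHomeomorph_source⟩
    have := (h1.toOpenPartialHomeomorph _).injOn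
    rwa [HasStrictFDerivAt.toOpenPartialHomeomorph_coe] at this
  choose O hO hinj hmem using key
  obtain ⟨t, -, ht, htU⟩ := TopologicalSpace.countable_cover_nhdsWithin (f := O)
    (s := {z | (derivative p).eval z ≠ 0})
    (fun z hz => mem_nhdsWithin_of_mem_nhds ((hO z).mem_nhds (hmem z hz)))
  rcases t.eq_empty_or_nonempty with rfl | hne
  · refine ⟨fun _ => ∅, fun _ => MeasurableSet.empty, fun _ _ _ => disjoint_bot_left,
      fun _ => Set.injOn_empty _, fun z hz => ?_⟩
    simpa using htU hz
  obtain ⟨e, rfl⟩ := ht.exists_eq_range hne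
  refine ⟨disjointed fun n => O (e n), fun n => ?_, disjoint_disjointed _, fun n => ?_,
    fun z hz => ?_⟩
  · exact MeasurableSet.disjointed (fun n => (hO (e n)).measurableSet) n
  · exact (hinj (e n)).mono (disjointed_le _ n)
  · have := htU hz
    rw [Set.biUnion_range, ← iUnion_disjointed] at this
    simpa using this

/-- The real Jacobian of p is |p'|², exactly the factor that cancels the denominator in the
push-forward of a quadratic differential. -/
theorem det_restrictScalars_toSpanSingleton (a : ℂ) :
    ((ContinuousLinearMap.toSpanSingleton ℂ a).restrictScalars ℝ : ℂ →L[ℝ] ℂ).det = ‖a‖ ^ 2 := by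
  simp [ContinuousLinearMap.det, LinearMap.det_restrictScalars, Algebra.norm_complex_eq,
    Complex.normSq_eq_norm_sq]

/-- The push-forward of quadratic differentials by a polynomial does not increase the mass. -/
theorem lintegral_enorm_le_of_transfer (p : ℂ[X]) (q : ℂ → ℂ) (hq : Measurable q) (X : Set ℂ)
    (hX : X.Countable)
    (hcrit : ∀ z, (derivative p).eval z = 0 → p.eval z ∈ X)
    (htr : ∀ y ∉ X, q y = ∑ u ∈ (p - C y).roots.toFinset, q u / (derivative p).eval u ^ 2)
    (B : Set ℂ) (hB : MeasurableSet B) :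
    ∫⁻ z in B, ‖q z‖ₑ ≤ ∫⁻ z in (fun z => p.eval z) ⁻¹' B, ‖q z‖ₑ := by
  classical
  obtain ⟨A, hAm, hAd, hAi, hAc⟩ := exists_injOn_partition p
  set f : ℂ → ℂ := fun z => p.eval z with hf
  have hfm : Measurable f := p.continuous.measurable
  let w : ℂ → ℝ≥0∞ := fun z => ‖q z / (derivative p).eval z ^ 2‖ₑ
  have hw : Measurable w :=
    (hq.div ((derivative p).continuous.measurable.pow_const 2)).enorm
  let S : ℕ → Set ℂ := fun n => (A n ∩ {z | (derivative p).eval z ≠ 0}) ∩ f ⁻¹' B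
  have hSm : ∀ n, MeasurableSet (S n) := fun n =>
    ((hAm n).inter ((isOpen_ne.preimage (derivative p).continuous).measurableSet)).inter (hfm hB)
  have hSi : ∀ n, Set.InjOn f (S n) := fun n => (hAi n).mono fun z hz => hz.1.1
  let f' : ℂ → ℂ →L[ℝ] ℂ := fun z =>
    (ContinuousLinearMap.toSpanSingleton ℂ ((derivative p).eval z)).restrictScalars ℝ
  have hf' : ∀ n, ∀ z ∈ S n, HasFDerivWithinAt f (f' z) (S n) z := fun n z _ =>
    ((p.hasDerivAt z).hasFDerivAt.restrictScalars ℝ).hasFDerivWithinAt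
  have hemb : ∀ n, MeasurableEmbedding ((S n).domRestrict f) := fun n =>
    measurableEmbedding_of_fderivWithin (hSm n) (hf' n) (hSi n)
  -- `F n` carries the weight on the piece `S n` to the image plane through the inverse branch of p,
  -- and is zero off the image of the piece.
  let F : ℕ → ℂ → ℝ≥0∞ := fun n =>
    Function.extend ((S n).domRestrict f) (fun z => w z) (fun _ => 0)
  have hFm : ∀ n, Measurable (F n) := fun n =>
    (hemb n).measurable_extend (hw.comp measurable_subtype_coe) measurable_const
  have hFval : ∀ n, ∀ z ∈ S n, F n (f z) = w z := fun n z hz =>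
    (hemb n).injective.extend_apply (fun z : S n => w z) (fun _ => 0) ⟨z, hz⟩
  have hFint : ∀ n, ∫⁻ y, F n y = ∫⁻ z in S n, ‖q z‖ₑ := by
    intro n
    have h1 : ∫⁻ y, F n y = ∫⁻ y in f '' S n, F n y := by
      rw [setLIntegral_eq_of_support_subset]
      intro y hy
      by_contra hcon
      refine hy (Function.extend_apply' _ _ _ ?_)
      rintro ⟨⟨z, hz⟩, rfl⟩
      exact hcon ⟨z, hz, rfl⟩
    rw [h1, lintegral_image_eq_lintegral_abs_det_fderiv_mul volume (hSm n) (hf' n) (hSi n)]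
    refine setLIntegral_congr_fun (hSm n) fun z hz => ?_
    have hz0 : (derivative p).eval z ≠ 0 := hz.1.2
    simp only [f']
    rw [hFval n z hz, det_restrictScalars_toSpanSingleton, abs_of_nonneg (by positivity),
      ← norm_pow, ofReal_norm, ← enorm_mul, mul_div_cancel₀ _ (pow_ne_zero 2 hz0)]
  have hpt : ∀ y ∈ B, y ∉ X → ‖q y‖ₑ ≤ ∑' n, F n y := by
    intro y hyB hyX
    have hroot : ∀ u ∈ (p - C y).roots.toFinset, p.eval u = y := by
      intro u hu
      have := (mem_roots'.1 (Multiset.mem_toFinset.1 hu)).2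
      simpa [sub_eq_zero] using this
    have hnc : ∀ u ∈ (p - C y).roots.toFinset, (derivative p).eval u ≠ 0 := fun u hu h0 =>
      hyX (hroot u hu ▸ hcrit u h0)
    choose! N hN using hAc
    have hmem : ∀ u ∈ (p - C y).roots.toFinset, u ∈ S (N u) := fun u hu =>
      ⟨⟨hN u (hnc u hu), hnc u hu⟩, by simpa [hf, hroot u hu] using hyB⟩
    calc ‖q y‖ₑ ≤ ∑ u ∈ (p - C y).roots.toFinset, w u := by
          rw [htr y hyX]; exact enorm_sum_le _ _
      _ = ∑ u ∈ (p - C y).roots.toFinset, F (N u) y := by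
          refine Finset.sum_congr rfl fun u hu => ?_
          rw [← hFval _ u (hmem u hu), hf]
          simp only [hroot u hu]
      _ = ∑ n ∈ (p - C y).roots.toFinset.image N, F n y := by
          -- Two points of the fibre in the same piece coincide, since p is injective there; so the
          -- fibre is indexed faithfully by its pieces.
          rw [Finset.sum_image]
          intro u hu v hv huv
          have hv' := hmem v hv
          rw [← huv] at hv'
          exact hSi _ (hmem u hu) hv' (by simp only [hf, hroot u hu, hroot v hv])
      _ ≤ ∑' n, F n y := ENNReal.sum_le_tsum _
  calc ∫⁻ z in B, ‖q z‖ₑ ≤ ∫⁻ y in B, ∑' n, F n y := by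
        refine lintegral_mono_ae ?_
        filter_upwards [ae_restrict_mem hB,
          ae_restrict_of_ae (hX.ae_notMem (volume : Measure ℂ))] with y hy hyX
        exact hpt y hy hyX
    _ ≤ ∫⁻ y, ∑' n, F n y := setLIntegral_le_lintegral _ _
    _ = ∑' n, ∫⁻ z in S n, ‖q z‖ₑ := by
        rw [lintegral_tsum fun n => (hFm n).aemeasurable]
        simp_rw [hFint]
    _ = ∫⁻ z in ⋃ n, S n, ‖q z‖ₑ := by
        rw [lintegral_iUnion hSm]
        intro m n hmn
        exact (hAd hmn).mono (fun z hz => hz.1.1) (fun z hz => hz.1.1)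
    _ ≤ ∫⁻ z in f ⁻¹' B, ‖q z‖ₑ :=
        lintegral_mono_set (Set.iUnion_subset fun n z hz => hz.2)

/-- A simple pole is integrable for area measure, so q has finite mass on discs and masses may be
subtracted. -/
theorem integrableOn_inv_sub (x : ℂ) (R : ℝ) :
    IntegrableOn (fun z : ℂ => (z - x)⁻¹) (Metric.ball 0 R) := by
  have h0 : LocallyIntegrable (fun z : ℂ => z⁻¹) := by
    refine locallyIntegrable_of_norm_le_rpow (C := 1) (α := 1) (by simp) (by simp)
      (Eventually.of_forall fun z => ?_) measurable_inv.aestronglyMeasurable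
    simp [Real.rpow_neg_one]
  have h1 : IntegrableOn (fun z : ℂ => z⁻¹) (Metric.ball 0 (R + ‖x‖)) :=
    (h0.integrableOn_isCompact (isCompact_closedBall 0 (R + ‖x‖))).mono_set
      Metric.ball_subset_closedBall
  have h2 := (measurePreserving_sub_right (volume : Measure ℂ) x).integrableOn_comp_preimage
    (Homeomorph.subRight x).measurableEmbedding |>.2 h1
  refine IntegrableOn.mono_set h2 fun z hz => ?_
  simp only [Set.mem_preimage, mem_ball_zero_iff] at hz ⊢
  exact (norm_sub_le _ _).trans_lt (by linarith)

/-- A quadratic differential with finitely many simple poles that is fixed by the push-forward by a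
polynomial of degree at least two vanishes. -/
theorem eq_zero_of_transfer {κ : Type*} [Fintype κ] (p : ℂ[X]) (hp : 2 ≤ p.natDegree)
    (a x : κ → ℂ) (T : Set ℂ) (hT : T.Countable)
    (hcrit : ∀ z, (derivative p).eval z = 0 → p.eval z ∈ T)
    (htr : ∀ y ∉ T, ∑ k, a k / (y - x k) =
      ∑ u ∈ (p - C y).roots.toFinset, (∑ k, a k / (u - x k)) / (derivative p).eval u ^ 2)
    (y : ℂ) (hy : y ∉ Set.range x) : ∑ k, a k / (y - x k) = 0 := by
  set q : ℂ → ℂ := fun z => ∑ k, a k / (z - x k) with hq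
  have hqm : Measurable q := by
    refine Finset.measurable_sum _ fun k _ => ?_
    exact measurable_const.div (measurable_id.sub_const _)
  have hfin : (Set.range x).Finite := Set.finite_range x
  have hopen : IsOpen (Set.range x)ᶜ := hfin.isClosed.isOpen_compl
  have hqd : DifferentiableOn ℂ q (Set.range x)ᶜ := by
    refine DifferentiableOn.fun_sum fun k _ => ?_
    refine (differentiableOn_const _).div (differentiableOn_id.sub_const _) fun z hz h0 => ?_
    exact hz ⟨k, (sub_eq_zero.1 h0).symm⟩
  -- Write p = X g + p(0) with g nonconstant, as the degree is at least two. Once |g| > 2 and |z| ≥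
  -- |p(0)| + 1, we get |p(z)| > 2|z| - |p(0)| > |z|.
  obtain ⟨R, hR0, hR⟩ : ∃ R : ℝ, 0 < R ∧ ∀ z : ℂ, R ≤ ‖z‖ → R < ‖p.eval z‖ := by
    obtain ⟨g, hg⟩ : ∃ g : ℂ[X], p = X * g + C (p.eval 0) :=
      ⟨p.divX, by rw [← coeff_zero_eq_eval_zero]; exact (X_mul_divX_add p).symm⟩
    have hgd : 0 < g.degree := by
      by_contra hcon
      rw [eq_C_of_degree_le_zero (not_lt.1 hcon)] at hg
      have : p.natDegree ≤ 1 := by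
        rw [hg, mul_comm]; exact natDegree_linear_le
      omega
    have ht := g.tendsto_norm_atTop hgd tendsto_norm_cobounded_atTop
    obtain ⟨r, hr⟩ : ∃ r : ℝ, ∀ z : ℂ, r ≤ ‖z‖ → 2 < ‖g.eval z‖ := by
      have := ht.eventually_gt_atTop 2
      rw [← comap_norm_atTop, eventually_comap] at this
      obtain ⟨r, hr⟩ := eventually_atTop.1 this
      exact ⟨r, fun z hz => hr _ hz z rfl⟩
    refine ⟨max r (‖p.eval 0‖ + 1), by positivity, fun z hz => ?_⟩
    have h1 := hr z ((le_max_left _ _).trans hz)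
    have h2 := (le_max_right _ _).trans hz
    have h3 : p.eval z = z * g.eval z + p.eval 0 := by
      conv_lhs => rw [hg]
      simp
    have h4 : ‖z * g.eval z‖ ≤ ‖p.eval z‖ + ‖p.eval 0‖ := by
      rw [eq_sub_of_add_eq h3.symm]; exact norm_sub_le _ _
    rw [norm_mul] at h4
    nlinarith [norm_nonneg z, norm_nonneg (p.eval 0)]
  set B : Set ℂ := Metric.ball 0 R with hBdef
  set B' : Set ℂ := (fun z => p.eval z) ⁻¹' B with hB'def
  have hBB : B' ⊆ B := by
    intro z hz
    simp only [hB'def, hBdef, Set.mem_preimage, mem_ball_zero_iff] at hz ⊢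
    by_contra hcon
    exact lt_asymm hz (hR z (not_lt.1 hcon))
  have hB'm : MeasurableSet B' := p.continuous.measurable Metric.isOpen_ball.measurableSet
  have hmass := lintegral_enorm_le_of_transfer p q hqm T hT hcrit htr B
    Metric.isOpen_ball.measurableSet
  have hint : IntegrableOn q B := by
    refine integrable_finsetSum _ fun k _ => ?_
    simp only [div_eq_mul_inv]
    exact (integrableOn_inv_sub (x k) R).const_mul (a k)
  -- The mass of q on B is at most its mass on B', which lies in B; finiteness lets the common part
  -- be cancelled.
  have hzero : ∫⁻ z in B \ B', ‖q z‖ₑ = 0 := by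
    have h1 := lintegral_inter_add_sdiff (μ := volume) (fun z => ‖q z‖ₑ) B hB'm
    rw [Set.inter_eq_self_of_subset_right hBB] at h1
    have hfinB : ∫⁻ z in B', ‖q z‖ₑ ≠ ⊤ :=
      ((lintegral_mono_set hBB).trans_lt hint.2).ne
    have h2 : (∫⁻ z in B', ‖q z‖ₑ) + ∫⁻ z in B \ B', ‖q z‖ₑ ≤ (∫⁻ z in B', ‖q z‖ₑ) + 0 := by
      rw [add_zero, h1]; exact hmass
    exact nonpos_iff_eq_zero.1 ((ENNReal.add_le_add_iff_left hfinB).1 h2)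
  set O : Set ℂ := (B ∩ {z | R < ‖p.eval z‖}) ∩ (Set.range x)ᶜ with hO
  have hO1 : IsOpen (B ∩ {z : ℂ | R < ‖p.eval z‖}) :=
    Metric.isOpen_ball.inter (isOpen_lt continuous_const p.continuous.norm)
  have hOo : IsOpen O := hO1.inter hopen
  have hOsub : O ⊆ B \ B' := by
    rintro z ⟨⟨hz1, hz2⟩, -⟩
    refine ⟨hz1, fun hz3 => ?_⟩
    simp only [hB'def, hBdef, Set.mem_preimage, mem_ball_zero_iff] at hz3
    exact lt_asymm (show R < ‖p.eval z‖ from hz2) hz3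
  have hOzero : Set.EqOn q 0 O := by
    refine Measure.eqOn_open_of_ae_eq (μ := volume) ?_ hOo
      (hqd.continuousOn.mono Set.inter_subset_right) continuousOn_const
    have h3 : ∫⁻ z in O, ‖q z‖ₑ = 0 :=
      nonpos_iff_eq_zero.1 ((lintegral_mono_set hOsub).trans hzero.le)
    rw [lintegral_eq_zero_iff hqm.enorm] at h3
    filter_upwards [h3] with z hz
    simpa using hz
  -- The boundary point R of B satisfies |p(R)| > R, so nearby points of B do too; finitely many
  -- poles can be avoided.
  have hOne : O.Nonempty := by
    have h1 : (R : ℂ) ∈ closure B := by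
      rw [hBdef, closure_ball _ hR0.ne']; simp [abs_of_pos hR0]
    have h2 : {z : ℂ | R < ‖p.eval z‖} ∈ 𝓝 (R : ℂ) :=
      (isOpen_lt continuous_const p.continuous.norm).mem_nhds
        (hR _ (by simp [abs_of_pos hR0]))
    obtain ⟨z, hz⟩ := mem_closure_iff_nhds.1 h1 _ h2
    obtain ⟨z', hz', hz''⟩ := (hfin.countable.dense_compl ℂ).inter_open_nonempty _ hO1 ⟨z, hz.2, hz.1⟩
    exact ⟨z', hz', hz''⟩
  obtain ⟨z, hz⟩ := hOne
  have hconn : IsPreconnected (Set.range x)ᶜ :=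
    (hfin.countable.isConnected_compl_of_one_lt_rank (by simp)).isPreconnected
  exact (hqd.analyticOnNhd hopen).eqOn_zero_of_preconnected_of_eventuallyEq_zero hconn hz.2
    (hOzero.eventuallyEq_of_mem (hOo.mem_nhds hz)) hy

end PolyTrans

/-! ### From a linear relation between variations to a fixed quadratic differential. -/

namespace PolyTrans

/-- Partial fraction decomposition of the inverse of a polynomial with simple roots. -/
theorem inv_eval_eq_sum_roots (r : ℂ[X]) (hr : 0 < r.natDegree)
    (hs : ∀ u, r.eval u = 0 → (derivative r).eval u ≠ 0) (z : ℂ) (hz : r.eval z ≠ 0) :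
    (r.eval z)⁻¹ = ∑ u ∈ r.roots.toFinset, ((derivative r).eval u)⁻¹ * (z - u)⁻¹ := by
  classical
  have hr0 : r ≠ 0 := by rintro rfl; simp at hr
  have hnd : r.roots.Nodup := by
    rw [Multiset.nodup_iff_count_le_one]
    intro u
    rw [count_roots]
    by_contra hcon
    have h1 := (one_lt_rootMultiplicity_iff_isRoot hr0).1 (not_le.1 hcon)
    exact hs u h1.1 h1.2
  set s := r.roots.toFinset with hsdef
  have hlead : r.leadingCoeff ≠ 0 := leadingCoeff_ne_zero.2 hr0
  have hfac : r = C r.leadingCoeff * Lagrange.nodal s id := by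
    conv_lhs => rw [(IsAlgClosed.splits r).eq_prod_roots]
    rw [Lagrange.nodal, Finset.prod, hsdef, Multiset.toFinset_val, hnd.dedup]
    rfl
  have hder : derivative r = C r.leadingCoeff * derivative (Lagrange.nodal s id) := by
    conv_lhs => rw [hfac]
    simp
  have hne : s.Nonempty := by
    obtain ⟨u, hu⟩ := IsAlgClosed.exists_root r (by
      rw [degree_eq_natDegree hr0]; exact_mod_cast hr.ne')
    exact ⟨u, by rw [hsdef]; simpa [hr0] using hu⟩
  -- Lagrange interpolation of the constant 1 at the roots of r, divided by r, is the partial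
  -- fraction expansion.
  have hbasis := congrArg (eval z) (Lagrange.sum_basis (s := s) (v := (id : ℂ → ℂ))
    Function.injective_id.injOn hne)
  have hzu : ∀ u ∈ s, z ≠ id u := by
    rintro u hu rfl
    rw [hsdef, Multiset.mem_toFinset, mem_roots'] at hu
    exact hz hu.2
  rw [eval_finsetSum, eval_one] at hbasis
  have hez : r.eval z = r.leadingCoeff * eval z (Lagrange.nodal s id) := by
    conv_lhs => rw [hfac]
    simp
  symm
  refine eq_inv_of_mul_eq_one_left ?_
  rw [← hbasis, Finset.sum_mul]
  refine Finset.sum_congr rfl fun u hu => ?_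
  rw [Lagrange.eval_basis_not_at_node hu (hzu u hu),
    Lagrange.nodalWeight_eq_eval_derivative_nodal hu, hez, hder]
  simp only [eval_mul, eval_C, id, mul_inv]
  field_simp

/-- The derivative of `p^[m - k]` at the point `p^[k] c`, by the chain rule. -/
noncomputable def orbitWeight (p : ℂ[X]) (c : ℂ) (m k : ℕ) : ℂ :=
  ∏ j ∈ Finset.Ico k m, (derivative p).eval ((fun z => p.eval z)^[j] c)

/-- The derivative of `p^[m] c - c` in the direction of a function with values `f`, when the
critical point `c` of `p` is followed and `s` is the derivative of the direction at `c`. -/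
noncomputable def critVariation (p : ℂ[X]) (c : ℂ) (m : ℕ) (f : ℂ → ℂ) (s : ℂ) : ℂ :=
  s / (derivative (derivative p)).eval c +
    ∑ k ∈ Finset.range m, orbitWeight p c m (k + 1) * f ((fun z => p.eval z)^[k] c)

theorem orbitWeight_self (p : ℂ[X]) (c : ℂ) (m : ℕ) : orbitWeight p c m m = 1 := by
  simp [orbitWeight]

theorem orbitWeight_eq_mul (p : ℂ[X]) (c : ℂ) {m k : ℕ} (hk : k < m) :
    orbitWeight p c m k =
      (derivative p).eval ((fun z => p.eval z)^[k] c) * orbitWeight p c m (k + 1) :=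
  Finset.prod_eq_prod_Ico_succ_bot hk _

theorem critVariation_add (p : ℂ[X]) (c : ℂ) (m : ℕ) (f g : ℂ → ℂ) (s t : ℂ) :
    critVariation p c m (fun z => f z + g z) (s + t) =
      critVariation p c m f s + critVariation p c m g t := by
  simp only [critVariation, mul_add, Finset.sum_add_distrib, add_div]
  ring

theorem critVariation_const_mul (p : ℂ[X]) (c : ℂ) (m : ℕ) (a : ℂ) (f : ℂ → ℂ) (s : ℂ) :
    critVariation p c m (fun z => a * f z) (a * s) = a * critVariation p c m f s := by
  simp only [critVariation, mul_add, Finset.mul_sum, mul_div_assoc]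
  congr 1
  exact Finset.sum_congr rfl fun k _ => by ring

theorem critVariation_sum {κ : Type*} (p : ℂ[X]) (c : ℂ) (m : ℕ) (t : Finset κ) (a : κ → ℂ)
    (f : κ → ℂ → ℂ) (s : κ → ℂ) :
    critVariation p c m (fun z => ∑ k ∈ t, a k * f k z) (∑ k ∈ t, a k * s k) =
      ∑ k ∈ t, a k * critVariation p c m (f k) (s k) := by
  classical
  induction t using Finset.induction_on with
  | empty => simp [critVariation]
  | insert k t hk ih =>
    simp only [Finset.sum_insert hk]
    rw [critVariation_add, ih, critVariation_const_mul]

/-- Only values on the orbit enter, so rational identities valid away from their poles can be used;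
the derivative at c is tracked separately by s. -/
theorem critVariation_congr (p : ℂ[X]) (c : ℂ) (m : ℕ) {f g : ℂ → ℂ} {s : ℂ}
    (h : ∀ k < m, f ((fun z => p.eval z)^[k] c) = g ((fun z => p.eval z)^[k] c)) :
    critVariation p c m f s = critVariation p c m g s := by
  simp only [critVariation]
  congr 1
  exact Finset.sum_congr rfl fun k hk => by rw [h k (Finset.mem_range.1 hk)]

section Periodic

variable (p : ℂ[X]) (c : ℂ) (m : ℕ)

theorem critVariation_inv_sub (y : ℂ) :
    critVariation p c m (fun z => (p.eval z - y)⁻¹) 0 =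
      -∑ k ∈ Finset.range m, orbitWeight p c m (k + 1) / (y - (fun z => p.eval z)^[k + 1] c) := by
  simp only [critVariation, zero_div, zero_add, ← Finset.sum_neg_distrib]
  refine Finset.sum_congr rfl fun k _ => ?_
  rw [Function.iterate_succ_apply', ← div_eq_mul_inv, ← div_neg, neg_sub]

/-- The quotient is p'/(z-u) - p'(u)/(z-u). In the variation of the first term, w_{k+1} p'(x_k) =
w_k shifts the index by one, and periodicity closes the cycle into the polar sum at u. -/
theorem critVariation_divByMonic (hc : (derivative p).eval c = 0)
    (hc2 : (derivative (derivative p)).eval c ≠ 0) (hm : 1 ≤ m)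
    (hper : (fun z => p.eval z)^[m] c = c) (u : ℂ)
    (hu : ∀ k < m, (fun z => p.eval z)^[k] c ≠ u) :
    critVariation p c m (fun z => (derivative p /ₘ (X - C u)).eval z)
        ((derivative (derivative p /ₘ (X - C u))).eval c) =
      -(∑ k ∈ Finset.range m, orbitWeight p c m (k + 1) / (u - (fun z => p.eval z)^[k + 1] c)) -
      (derivative p).eval u * critVariation p c m (fun z => (z - u)⁻¹) (-((c - u) ^ 2)⁻¹) := by
  set g := derivative p /ₘ (X - C u) with hg
  have hpg : derivative p = (X - C u) * g + C ((derivative p).eval u) := by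
    conv_lhs => rw [← modByMonic_add_div (derivative p) (X - C u), modByMonic_X_sub_C_eq_C_eval,
      add_comm]
  have hcu : c - u ≠ 0 := sub_ne_zero.2 (hu 0 hm)
  have hval : ∀ z, (derivative p).eval z = (z - u) * g.eval z + (derivative p).eval u := by
    intro z
    conv_lhs => rw [hpg]
    simp
  have hgz : ∀ z, z ≠ u →
      g.eval z = (derivative p).eval z * (z - u)⁻¹ - (derivative p).eval u * (z - u)⁻¹ := by
    intro z hz
    have := sub_ne_zero.2 hz
    rw [hval z]
    field_simp
    ring
  have hg' : (derivative g).eval c =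
      (derivative (derivative p)).eval c / (c - u) + (derivative p).eval u * ((c - u) ^ 2)⁻¹ := by
    have h1 : (derivative (derivative p)).eval c = g.eval c + (c - u) * (derivative g).eval c := by
      conv_lhs => rw [hpg]
      simp [derivative_mul]
    rw [h1, hgz c (hu 0 hm), hc]
    field_simp
    ring
  have hsum : (c - u)⁻¹ + ∑ k ∈ Finset.range m, orbitWeight p c m (k + 1) *
        ((derivative p).eval ((fun z => p.eval z)^[k] c) * ((fun z => p.eval z)^[k] c - u)⁻¹) =
      -∑ k ∈ Finset.range m, orbitWeight p c m (k + 1) / (u - (fun z => p.eval z)^[k + 1] c) := by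
    -- Split the sum over 0 ≤ k ≤ m at either end: the term k = m is 1/(c-u) by periodicity, and the
    -- term k = 0 vanishes because p'(c) = 0.
    have h2 := Finset.sum_range_succ' (fun k => orbitWeight p c m k *
      ((fun z => p.eval z)^[k] c - u)⁻¹) m
    rw [Finset.sum_range_succ, orbitWeight_self, hper, orbitWeight_eq_mul p c hm,
      Function.iterate_zero_apply, hc, zero_mul, zero_mul, add_zero, one_mul] at h2
    rw [← Finset.sum_neg_distrib]
    calc _ = ∑ k ∈ Finset.range m, orbitWeight p c m k * ((fun z => p.eval z)^[k] c - u)⁻¹ +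
          (c - u)⁻¹ := by
          rw [add_comm]
          congr 1
          refine Finset.sum_congr rfl fun k hk => ?_
          rw [orbitWeight_eq_mul p c (Finset.mem_range.1 hk)]
          ring
      _ = _ := by
          rw [h2]
          refine Finset.sum_congr rfl fun k _ => ?_
          rw [← div_eq_mul_inv, ← div_neg, neg_sub]
  rw [← hsum]
  simp only [critVariation]
  rw [hg', mul_add, Finset.mul_sum]
  have h3 : ∑ k ∈ Finset.range m, orbitWeight p c m (k + 1) *
      g.eval ((fun z => p.eval z)^[k] c) =
    ∑ k ∈ Finset.range m, orbitWeight p c m (k + 1) *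
        ((derivative p).eval ((fun z => p.eval z)^[k] c) * ((fun z => p.eval z)^[k] c - u)⁻¹) -
    ∑ k ∈ Finset.range m, (derivative p).eval u *
      (orbitWeight p c m (k + 1) * ((fun z => p.eval z)^[k] c - u)⁻¹) := by
    rw [← Finset.sum_sub_distrib]
    refine Finset.sum_congr rfl fun k hk => ?_
    rw [hgz _ (hu k (Finset.mem_range.1 hk))]
    ring
  rw [h3]
  field_simp
  ring

end Periodic

/-- If a combination of the variations kills all polynomials of degree at most `deg p`, then the
associated quadratic differential is fixed by the push-forward by `p`. -/
theorem transfer_eq_of_critVariation {ι : Type*} [Fintype ι] (p : ℂ[X]) (hp : 0 < p.natDegree)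
    (c : ι → ℂ) (m : ι → ℕ) (l : ι → ℂ) (hc : ∀ i, (derivative p).eval (c i) = 0)
    (hc2 : ∀ i, (derivative (derivative p)).eval (c i) ≠ 0) (hm : ∀ i, 1 ≤ m i)
    (hper : ∀ i, (fun z => p.eval z)^[m i] (c i) = c i)
    (hL : ∀ g : ℂ[X], g.natDegree ≤ p.natDegree →
      ∑ i, l i * critVariation p (c i) (m i) (fun z => g.eval z) ((derivative g).eval (c i)) = 0)
    (y : ℂ) (hy : ∀ i, ∀ k < m i, (fun z => p.eval z)^[k + 1] (c i) ≠ y)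
    (hcrit : ∀ z, (derivative p).eval z = 0 → p.eval z ≠ y) :
    ∑ i, l i * ∑ k ∈ Finset.range (m i),
        orbitWeight p (c i) (m i) (k + 1) / (y - (fun z => p.eval z)^[k + 1] (c i)) =
      ∑ u ∈ (p - C y).roots.toFinset, (∑ i, l i * ∑ k ∈ Finset.range (m i),
        orbitWeight p (c i) (m i) (k + 1) / (u - (fun z => p.eval z)^[k + 1] (c i))) /
          (derivative p).eval u ^ 2 := by
  classical
  set s := (p - C y).roots.toFinset with hs
  have hroot : ∀ u ∈ s, p.eval u = y := by
    intro u hu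
    have := (mem_roots'.1 (Multiset.mem_toFinset.1 hu)).2
    simpa [sub_eq_zero] using this
  have hnc : ∀ u ∈ s, (derivative p).eval u ≠ 0 := fun u hu h0 => hcrit u h0 (hroot u hu)
  have horb : ∀ i, ∀ k < m i, p.eval ((fun z => p.eval z)^[k] (c i)) ≠ y := by
    intro i k hk
    have := hy i k hk
    rwa [Function.iterate_succ_apply'] at this
  have hpf : ∀ z, p.eval z ≠ y →
      (p.eval z - y)⁻¹ = ∑ u ∈ s, ((derivative p).eval u)⁻¹ * (z - u)⁻¹ := by
    intro z hz
    have := inv_eval_eq_sum_roots (p - C y) (by rwa [natDegree_sub_C])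
      (fun u hu => by
        simp only [derivative_sub, derivative_C, sub_zero]
        intro h0
        exact hcrit u h0 (by simpa [sub_eq_zero] using hu)) z (by simpa [sub_eq_zero] using hz)
    simpa using this
  have hci : ∀ i, p.eval (c i) ≠ y := fun i => horb i 0 (hm i)
  have hcu : ∀ i, ∀ u ∈ s, c i - u ≠ 0 := by
    intro i u hu h0
    exact hci i (by rw [sub_eq_zero.1 h0, hroot u hu])
  -- Differentiate the partial fractions at c_i, where 1/(p-y) is stationary.
  have hpf' : ∀ i, (0 : ℂ) = ∑ u ∈ s, ((derivative p).eval u)⁻¹ * (-((c i - u) ^ 2)⁻¹) := by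
    intro i
    have h1 : HasDerivAt (fun z => (p.eval z - y)⁻¹) 0 (c i) := by
      have := ((p.hasDerivAt (c i)).sub_const y).fun_inv (sub_ne_zero.2 (hci i))
      simpa [hc i] using this
    have h2 : HasDerivAt (fun z => ∑ u ∈ s, ((derivative p).eval u)⁻¹ * (z - u)⁻¹)
        (∑ u ∈ s, ((derivative p).eval u)⁻¹ * (-((c i - u) ^ 2)⁻¹)) (c i) := by
      refine HasDerivAt.fun_sum fun u hu => HasDerivAt.const_mul _ ?_
      have := ((hasDerivAt_id (c i)).sub_const u).fun_inv (hcu i u hu)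
      simpa [neg_div] using this
    refine h1.unique (h2.congr_of_eventuallyEq ?_)
    filter_upwards [p.continuous.continuousAt.eventually_ne (hci i)] with z hz
    exact hpf z hz
  -- This is q(u) = -p'(u) L(1/(z-u)): the relation `hL` is tested on p' divided by X - u.
  have hkill : ∀ u ∈ s, ∑ i, l i * ∑ k ∈ Finset.range (m i),
        orbitWeight p (c i) (m i) (k + 1) / (u - (fun z => p.eval z)^[k + 1] (c i)) =
      -((derivative p).eval u * ∑ i, l i *
        critVariation p (c i) (m i) (fun z => (z - u)⁻¹) (-((c i - u) ^ 2)⁻¹)) := by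
    intro u hu
    have h1 := hL (derivative p /ₘ (X - C u)) (by
      rw [natDegree_divByMonic _ (monic_X_sub_C u)]
      exact (Nat.sub_le _ _).trans ((natDegree_derivative_le p).trans (Nat.sub_le _ _)))
    have h2 : ∀ i, ∀ k < m i, (fun z => p.eval z)^[k] (c i) ≠ u := by
      rintro i k hk rfl
      exact horb i k hk (hroot _ hu)
    simp_rw [fun i => critVariation_divByMonic p (c i) (m i) (hc i) (hc2 i) (hm i) (hper i) u
      (h2 i)] at h1
    simp only [mul_sub, mul_neg, Finset.sum_sub_distrib, Finset.sum_neg_distrib] at h1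
    rw [Finset.mul_sum, eq_neg_iff_add_eq_zero, ← neg_eq_zero, neg_add, ← sub_eq_add_neg, ← h1]
    congr 1
    exact Finset.sum_congr rfl fun i _ => by ring
  have hmain : ∀ i, -(∑ k ∈ Finset.range (m i),
        orbitWeight p (c i) (m i) (k + 1) / (y - (fun z => p.eval z)^[k + 1] (c i))) =
      ∑ u ∈ s, ((derivative p).eval u)⁻¹ *
        critVariation p (c i) (m i) (fun z => (z - u)⁻¹) (-((c i - u) ^ 2)⁻¹) := by
    intro i
    rw [← critVariation_inv_sub, ← critVariation_sum, ← hpf' i]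
    exact critVariation_congr _ _ _ fun k hk => hpf _ (horb i k hk)
  calc _ = -∑ i, l i * -(∑ k ∈ Finset.range (m i),
        orbitWeight p (c i) (m i) (k + 1) / (y - (fun z => p.eval z)^[k + 1] (c i))) := by
        simp
    _ = -∑ u ∈ s, ((derivative p).eval u)⁻¹ * ∑ i, l i *
        critVariation p (c i) (m i) (fun z => (z - u)⁻¹) (-((c i - u) ^ 2)⁻¹) := by
        simp_rw [hmain, Finset.mul_sum]
        rw [Finset.sum_comm]
        congr 1
        exact Finset.sum_congr rfl fun u _ => Finset.sum_congr rfl fun i _ => by ring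
    _ = _ := by
        rw [← Finset.sum_neg_distrib]
        refine Finset.sum_congr rfl fun u hu => ?_
        rw [hkill u hu]
        have := hnc u hu
        field_simp

/-- Multiply by z - y and let z tend to y. Poles may be repeated in the family, so only the total
residue at y is controlled. -/
theorem sum_residue_eq_zero {κ : Type*} [Fintype κ] [DecidableEq ℂ] (a x : κ → ℂ)
    (h : ∀ y ∉ Set.range x, ∑ k, a k / (y - x k) = 0) (y : ℂ) :
    ∑ k, (if x k = y then a k else 0) = 0 := by
  have h1 : Tendsto (fun z => ∑ k, (z - y) * (a k / (z - x k))) (𝓝[≠] y)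
      (𝓝 (∑ k, (if x k = y then a k else 0))) := by
    refine tendsto_finsetSum _ fun k _ => ?_
    split_ifs with hk
    · refine tendsto_const_nhds.congr' ?_
      filter_upwards [self_mem_nhdsWithin] with z hz
      rw [hk, mul_div_cancel₀ _ (sub_ne_zero.2 hz)]
    · have h2 : ContinuousAt (fun z => (z - y) * (a k / (z - x k))) y :=
        ContinuousAt.mul (by fun_prop) (ContinuousAt.div (by fun_prop) (by fun_prop)
          (sub_ne_zero.2 (Ne.symm hk)))
      have h3 := h2.tendsto.mono_left (nhdsWithin_le_nhds (s := {y}ᶜ))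
      simpa using h3
  refine tendsto_nhds_unique h1 (tendsto_const_nhds.congr' ?_)
  have h4 : (Set.range x \ {y})ᶜ ∈ 𝓝 y :=
    ((Set.finite_range x).sdiff).isClosed.isOpen_compl.mem_nhds (by simp)
  filter_upwards [self_mem_nhdsWithin, nhdsWithin_le_nhds h4] with z hz hz'
  rw [← Finset.mul_sum, h z (fun hcon => hz' ⟨hcon, hz⟩), mul_zero]

/-- The variations at distinct simple periodic critical points are linearly independent. -/
theorem eq_zero_of_critVariation {ι : Type*} [Fintype ι] (p : ℂ[X]) (hp : 2 ≤ p.natDegree)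
    (c : ι → ℂ) (hinj : Function.Injective c) (m : ι → ℕ) (l : ι → ℂ)
    (hc : ∀ i, (derivative p).eval (c i) = 0)
    (hc2 : ∀ i, (derivative (derivative p)).eval (c i) ≠ 0) (hm : ∀ i, 1 ≤ m i)
    (hper : ∀ i, (fun z => p.eval z)^[m i] (c i) = c i)
    (hL : ∀ g : ℂ[X], g.natDegree ≤ p.natDegree →
      ∑ i, l i * critVariation p (c i) (m i) (fun z => g.eval z) ((derivative g).eval (c i)) = 0)
    (j : ι) : l j = 0 := by
  classical
  let a : (Σ i, Fin (m i)) → ℂ := fun k => l k.1 * orbitWeight p (c k.1) (m k.1) (k.2 + 1)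
  let x : (Σ i, Fin (m i)) → ℂ := fun k => (fun z => p.eval z)^[(k.2 : ℕ) + 1] (c k.1)
  have hsum : ∀ y, ∑ k, a k / (y - x k) = ∑ i, l i * ∑ k ∈ Finset.range (m i),
      orbitWeight p (c i) (m i) (k + 1) / (y - (fun z => p.eval z)^[k + 1] (c i)) := by
    intro y
    rw [Fintype.sum_sigma]
    refine Finset.sum_congr rfl fun i _ => ?_
    rw [Finset.sum_range, Finset.mul_sum]
    exact Finset.sum_congr rfl fun k _ => mul_div_assoc _ _ _
  have hp' : derivative p ≠ 0 := by
    intro h0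
    have := derivative_eq_zero.1 h0
    omega
  have hcf : {z | (derivative p).eval z = 0}.Finite := by
    refine (derivative p).roots.toFinset.finite_toSet.subset fun z hz => ?_
    simpa [hp'] using hz
  have hq : ∀ y ∉ Set.range x, ∑ k, a k / (y - x k) = 0 := by
    refine eq_zero_of_transfer p hp a x
      (Set.range x ∪ (fun z => p.eval z) '' {z | (derivative p).eval z = 0})
      ((Set.finite_range x).union (hcf.image _)).countable
      (fun z hz => Or.inr ⟨z, hz, rfl⟩) fun y hy => ?_
    simp_rw [hsum]
    refine transfer_eq_of_critVariation p (by omega) c m l hc hc2 hm hper hL y ?_ ?_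
    · rintro i k hk rfl
      exact hy (Or.inl ⟨⟨i, ⟨k, hk⟩⟩, rfl⟩)
    · rintro z hz rfl
      exact hy (Or.inr ⟨z, hz, rfl⟩)
  have hres := sum_residue_eq_zero a x hq (c j)
  -- The closing step k + 1 = m_j has weight 1. An earlier visit to c_j, by any orbit, has weight
  -- containing p'(c_j) = 0; another orbit closes at its own c_i ≠ c_j. Thus m_j need not be the
  -- minimal period.
  rw [Fintype.sum_eq_single (⟨j, ⟨m j - 1, by have := hm j; omega⟩⟩ : Σ i, Fin (m i))] at hres
  · have hmj : m j - 1 + 1 = m j := Nat.sub_add_cancel (hm j)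
    simp only [a, x] at hres
    rwa [hmj, hper j, if_pos rfl, orbitWeight_self, mul_one] at hres
  · rintro ⟨i, k⟩ hne
    rw [ite_eq_right_iff]
    intro hk
    simp only [x] at hk
    have hk2 := k.2
    rcases Nat.lt_or_ge ((k : ℕ) + 1) (m i) with hlt | hge
    · simp only [a]
      rw [orbitWeight_eq_mul p (c i) hlt, hk, hc, zero_mul, mul_zero]
    · exfalso
      have hkm : (k : ℕ) + 1 = m i := by omega
      rw [hkm, hper i] at hk
      obtain rfl := hinj hk
      exact hne (by congr 1; ext; simp; omega)

end PolyTrans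

/-! ### Coefficient vectors as polynomials. -/

namespace PolyTrans

open scoped ContDiff

section Coefficients

variable {d : ℕ}

theorem coeff_toPoly (b : Fin (d + 1) → ℂ) (i : Fin (d + 1)) : (toPoly b).coeff i = b i := by
  simp only [toPoly, finsetSum_coeff, coeff_C_mul_X_pow]
  rw [Finset.sum_eq_single i]
  · simp
  · intro j _ hj
    rw [if_neg]
    exact fun h => hj (Fin.ext h.symm)
  · simp

theorem natDegree_toPoly_le (b : Fin (d + 1) → ℂ) : (toPoly b).natDegree ≤ d := by
  refine natDegree_sum_le_of_forall_le _ _ fun i _ => ?_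
  exact (natDegree_C_mul_X_pow_le _ _).trans (Nat.lt_succ_iff.1 i.2)

theorem toPoly_coeff (g : ℂ[X]) (hg : g.natDegree ≤ d) :
    toPoly (fun i : Fin (d + 1) => g.coeff i) = g := by
  rw [toPoly, Fin.sum_univ_eq_sum_range (fun i => C (g.coeff i) * X ^ i) (d + 1)]
  exact (as_sum_range_C_mul_X_pow' g (Nat.lt_succ_of_le hg)).symm

theorem toPoly_injective : Function.Injective (toPoly : (Fin (d + 1) → ℂ) → ℂ[X]) := by
  intro a b h
  funext i
  rw [← coeff_toPoly a, ← coeff_toPoly b, h]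

theorem ext_of_dyn_eq {a b : Fin (d + 1) → ℂ} (h : ∀ z, dyn a z = dyn b z) : a = b :=
  toPoly_injective (Polynomial.funext h)

theorem natDegree_toPoly {b : Fin (d + 1) → ℂ} (hb : b ∈ PolyD d) :
    (toPoly b).natDegree = d := by
  refine le_antisymm (natDegree_toPoly_le b) (le_natDegree_of_ne_zero ?_)
  have := coeff_toPoly b (Fin.last d)
  rw [Fin.val_last] at this
  rw [this]
  exact hb

theorem isOpen_polyD : IsOpen (PolyD d) :=
  isOpen_ne.preimage (continuous_apply (Fin.last d))

theorem natDegree_derivative_toPoly {b : Fin (d + 1) → ℂ} (hb : b ∈ PolyD d) :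
    (derivative (toPoly b)).natDegree = d - 1 := by
  rw [natDegree_derivative, natDegree_toPoly hb]

theorem derivative_toPoly_ne_zero (hd : 2 ≤ d) {b : Fin (d + 1) → ℂ} (hb : b ∈ PolyD d) :
    derivative (toPoly b) ≠ 0 := by
  intro h
  have := derivative_eq_zero.1 h
  rw [natDegree_toPoly hb] at this
  omega

/-- Evaluation of polynomials at a point, as a continuous linear form on coefficient vectors. -/
noncomputable def evalCLM (d : ℕ) (z : ℂ) : (Fin (d + 1) → ℂ) →L[ℂ] ℂ :=
  ∑ i : Fin (d + 1), (z ^ (i : ℕ)) • ContinuousLinearMap.proj i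

theorem evalCLM_apply (z : ℂ) (b : Fin (d + 1) → ℂ) : evalCLM d z b = (toPoly b).eval z := by
  simp only [evalCLM, toPoly, eval_finsetSum, eval_mul, eval_C, eval_pow, eval_X, sum_apply,
    smul_apply, ContinuousLinearMap.proj_apply, smul_eq_mul]
  exact Finset.sum_congr rfl fun i _ => mul_comm _ _

/-- Evaluation of derivatives of polynomials at a point, as a continuous linear form on coefficient
vectors. -/
noncomputable def evalDerivCLM (d : ℕ) (z : ℂ) : (Fin (d + 1) → ℂ) →L[ℂ] ℂ :=
  ∑ i : Fin (d + 1), ((derivative (X ^ (i : ℕ) : ℂ[X])).eval z) • ContinuousLinearMap.proj i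

theorem derivative_toPoly (b : Fin (d + 1) → ℂ) :
    derivative (toPoly b) = ∑ i : Fin (d + 1), C (b i) * derivative (X ^ (i : ℕ)) := by
  simp only [toPoly, derivative_sum, derivative_C_mul]

theorem evalDerivCLM_apply (z : ℂ) (b : Fin (d + 1) → ℂ) :
    evalDerivCLM d z b = (derivative (toPoly b)).eval z := by
  rw [derivative_toPoly]
  simp only [evalDerivCLM, eval_finsetSum, eval_mul, eval_C, sum_apply,
    smul_apply, ContinuousLinearMap.proj_apply, smul_eq_mul]
  exact Finset.sum_congr rfl fun i _ => mul_comm _ _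

end Coefficients

/-! ### Differentials of marked critical points and of their iterates. -/

section Calculus

variable {d : ℕ}

/-- Taking for f the monomials, or their derivatives, treats the evaluation of Q and of Q' at a
moving point at once. -/
theorem hasFDerivAt_sum_mul_eval {n : ℕ} (f : Fin n → ℂ[X]) {γ : (Fin n → ℂ) → ℂ}
    {γ' : (Fin n → ℂ) →L[ℂ] ℂ} {P : Fin n → ℂ} (hγ : HasFDerivAt γ γ' P) :
    HasFDerivAt (fun Q : Fin n → ℂ => ∑ i, Q i * (f i).eval (γ Q))
      ((∑ i, ((f i).eval (γ P)) • (ContinuousLinearMap.proj i : (Fin n → ℂ) →L[ℂ] ℂ)) +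
        (∑ i, P i * (derivative (f i)).eval (γ P)) • γ') P := by
  have h1 : ∀ i : Fin n, HasFDerivAt (fun Q : Fin n → ℂ => Q i * (f i).eval (γ Q))
      (P i • ((derivative (f i)).eval (γ P) • γ') +
        ((f i).eval (γ P)) • (ContinuousLinearMap.proj i : (Fin n → ℂ) →L[ℂ] ℂ)) P := fun i =>
    (hasFDerivAt_apply i P).mul (((f i).hasDerivAt (γ P)).comp_hasFDerivAt P hγ)
  refine (HasFDerivAt.fun_sum fun i _ => h1 i).congr_fderiv ?_
  ext v
  simp only [sum_apply, add_apply,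
    smul_apply, ContinuousLinearMap.proj_apply, smul_eq_mul,
    Finset.sum_add_distrib, Finset.sum_mul]
  rw [add_comm]
  congr 1
  exact Finset.sum_congr rfl fun i _ => by ring

theorem eval_toPoly (b : Fin (d + 1) → ℂ) (z : ℂ) :
    (toPoly b).eval z = ∑ i, b i * (X ^ (i : ℕ) : ℂ[X]).eval z := by
  simp [toPoly, eval_finsetSum]

theorem eval_derivative_toPoly (b : Fin (d + 1) → ℂ) (z : ℂ) :
    (derivative (toPoly b)).eval z =
      ∑ i, b i * (derivative (X ^ (i : ℕ) : ℂ[X])).eval z := by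
  simp only [derivative_toPoly, eval_finsetSum, eval_mul, eval_C]

theorem eval_derivative_derivative_toPoly (b : Fin (d + 1) → ℂ) (z : ℂ) :
    (derivative (derivative (toPoly b))).eval z =
      ∑ i, b i * (derivative (derivative (X ^ (i : ℕ) : ℂ[X]))).eval z := by
  simp only [derivative_toPoly, derivative_sum, derivative_C_mul, eval_finsetSum, eval_mul, eval_C]

variable {γ : (Fin (d + 1) → ℂ) → ℂ} {γ' : (Fin (d + 1) → ℂ) →L[ℂ] ℂ} {P : Fin (d + 1) → ℂ}

theorem hasFDerivAt_dyn (hγ : HasFDerivAt γ γ' P) :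
    HasFDerivAt (fun Q => dyn Q (γ Q))
      (evalCLM d (γ P) + (derivative (toPoly P)).eval (γ P) • γ') P := by
  have := hasFDerivAt_sum_mul_eval (fun i : Fin (d + 1) => (X ^ (i : ℕ) : ℂ[X])) hγ
  simp only [dyn, evalCLM, eval_toPoly, eval_derivative_toPoly]
  simpa only [eval_pow, eval_X] using this

theorem hasFDerivAt_eval_derivative (hγ : HasFDerivAt γ γ' P) :
    HasFDerivAt (fun Q => (derivative (toPoly Q)).eval (γ Q))
      (evalDerivCLM d (γ P) + (derivative (derivative (toPoly P))).eval (γ P) • γ') P := by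
  have := hasFDerivAt_sum_mul_eval (fun i : Fin (d + 1) => derivative (X ^ (i : ℕ) : ℂ[X])) hγ
  simp only [evalDerivCLM, eval_derivative_toPoly, eval_derivative_derivative_toPoly]
  exact this

theorem hasFDerivAt_iterate_dyn (hγ : HasFDerivAt γ γ' P) (m : ℕ) :
    HasFDerivAt (fun Q => (dyn Q)^[m] (γ Q))
      ((∑ k ∈ Finset.range m, orbitWeight (toPoly P) (γ P) m (k + 1) •
        evalCLM d ((dyn P)^[k] (γ P))) + orbitWeight (toPoly P) (γ P) m 0 • γ') P := by
  induction m with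
  | zero => simpa [orbitWeight] using hγ
  | succ m ih =>
    have h1 := hasFDerivAt_dyn ih
    simp only [Function.iterate_succ_apply']
    refine h1.congr_fderiv ?_
    have hw : ∀ k ≤ m, orbitWeight (toPoly P) (γ P) (m + 1) k =
        (derivative (toPoly P)).eval ((dyn P)^[m] (γ P)) * orbitWeight (toPoly P) (γ P) m k := by
      intro k hk
      rw [orbitWeight, Finset.prod_Ico_succ_top hk, mul_comm]
      rfl
    rw [Finset.sum_range_succ, orbitWeight_self, one_smul, smul_add, smul_smul,
      hw 0 (Nat.zero_le m), Finset.smul_sum]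
    have : ∑ k ∈ Finset.range m, orbitWeight (toPoly P) (γ P) (m + 1) (k + 1) •
          evalCLM d ((dyn P)^[k] (γ P)) =
        ∑ k ∈ Finset.range m, (derivative (toPoly P)).eval ((dyn P)^[m] (γ P)) •
          orbitWeight (toPoly P) (γ P) m (k + 1) • evalCLM d ((dyn P)^[k] (γ P)) := by
      refine Finset.sum_congr rfl fun k hk => ?_
      rw [hw _ (Finset.mem_range.1 hk), smul_smul]
    rw [this]
    abel

/-- The derivative of a marked simple critical point. -/
theorem fderiv_critPt (hγ : DifferentiableAt ℂ γ P)
    (hcrit : ∀ᶠ Q in 𝓝 P, (derivative (toPoly Q)).eval (γ Q) = 0)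
    (hsimple : (derivative (derivative (toPoly P))).eval (γ P) ≠ 0) (v : Fin (d + 1) → ℂ) :
    fderiv ℂ γ P v =
      -((derivative (toPoly v)).eval (γ P) / (derivative (derivative (toPoly P))).eval (γ P)) := by
  have h1 := hasFDerivAt_eval_derivative hγ.hasFDerivAt
  have h2 : HasFDerivAt (fun Q => (derivative (toPoly Q)).eval (γ Q))
      (0 : (Fin (d + 1) → ℂ) →L[ℂ] ℂ) P :=
    (hasFDerivAt_const (0 : ℂ) P).congr_of_eventuallyEq hcrit
  have h3 := congrArg (fun L => L v) (h1.unique h2)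
  simp only [add_apply, smul_apply, smul_eq_mul,
    evalDerivCLM_apply, zero_apply] at h3
  rw [← neg_div, eq_div_iff hsimple]
  linear_combination h3

/-- The motion of the critical point does not affect its iterate to first order, since the factor
p'(c) = 0 occurs; it enters only through the subtracted γ. -/
theorem fderiv_iterate_sub (hγ : DifferentiableAt ℂ γ P)
    (hcrit : ∀ᶠ Q in 𝓝 P, (derivative (toPoly Q)).eval (γ Q) = 0)
    (hsimple : (derivative (derivative (toPoly P))).eval (γ P) ≠ 0) {m : ℕ} (hm : 1 ≤ m)
    (v : Fin (d + 1) → ℂ) :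
    fderiv ℂ (fun Q => (dyn Q)^[m] (γ Q) - γ Q) P v =
      critVariation (toPoly P) (γ P) m (fun z => (toPoly v).eval z)
        ((derivative (toPoly v)).eval (γ P)) := by
  rw [((hasFDerivAt_iterate_dyn hγ.hasFDerivAt m).fun_sub hγ.hasFDerivAt).fderiv]
  rw [orbitWeight_eq_mul (toPoly P) (γ P) hm, Function.iterate_zero_apply,
    hcrit.self_of_nhds, zero_mul]
  simp only [sub_apply, sum_apply,
    add_apply, smul_apply, smul_eq_mul, evalCLM_apply, critVariation, zero_mul, add_zero,
    fderiv_critPt hγ hcrit hsimple v]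
  rw [sub_neg_eq_add, add_comm]
  rfl

theorem differentiableAt_iterate_dyn (hγ : DifferentiableAt ℂ γ P) (m : ℕ) :
    DifferentiableAt ℂ (fun Q => (dyn Q)^[m] (γ Q)) P :=
  (hasFDerivAt_iterate_dyn hγ.hasFDerivAt m).differentiableAt

theorem contDiff_dyn : ContDiff ℂ ω (fun x : (Fin (d + 1) → ℂ) × ℂ => dyn x.1 x.2) := by
  simp only [dyn, eval_toPoly, eval_pow, eval_X]
  fun_prop

theorem contDiff_eval_derivative :
    ContDiff ℂ ω (fun x : (Fin (d + 1) → ℂ) × ℂ => (derivative (toPoly x.1)).eval x.2) := by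
  simp only [eval_derivative_toPoly, derivative_X_pow, eval_mul, eval_pow, eval_X, eval_C]
  fun_prop

theorem contDiffAt_iterate_dyn (hγ : ContDiffAt ℂ ω γ P) (m : ℕ) :
    ContDiffAt ℂ ω (fun Q => (dyn Q)^[m] (γ Q)) P := by
  induction m with
  | zero => simpa using hγ
  | succ m ih =>
    simp only [Function.iterate_succ_apply']
    exact (contDiff_dyn (d := d)).contDiffAt.comp P (contDiffAt_id.prodMk ih)

end Calculus

/-! ### Holomorphic implicit functions. -/

section Implicit

variable {E : Type*} [NormedAddCommGroup E] [NormedSpace ℂ E] [CompleteSpace E]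

/-- The holomorphic implicit function theorem for one equation. -/
theorem exists_implicit {f : E × ℂ → ℂ} {x : E} {z : ℂ} (hf : ContDiffAt ℂ ω f (x, z))
    (h0 : f (x, z) = 0) (hne : fderiv ℂ f (x, z) (0, 1) ≠ 0) :
    ∃ ψ : E → ℂ, ContDiffAt ℂ ω ψ x ∧ ψ x = z ∧ (∀ᶠ y in 𝓝 x, f (y, ψ y) = 0) ∧
      ∀ᶠ y in 𝓝 (x, z), f y = 0 → ψ y.1 = y.2 := by
  have hinv : (fderiv ℂ f (x, z) ∘L .inr ℂ E ℂ).IsInvertible := by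
    refine ⟨ContinuousLinearEquiv.unitsEquivAut ℂ (Units.mk0 _ hne), ?_⟩
    ext
    simp
  refine ⟨hf.implicitFunction (by simp) hinv, hf.contDiffAt_implicitFunction (by simp) hinv,
    hf.implicitFunction_apply_self (by simp) hinv, ?_, ?_⟩
  · filter_upwards [hf.eventually_apply_implicitFunction (by simp) hinv] with y hy
    rw [hy, h0]
  · filter_upwards [hf.eventually_apply_eq_iff_implicitFunction (by simp) hinv] with y hy hy0
    exact hy.1 (hy0.trans h0.symm)

end Implicit

end PolyTrans

/-! ### Tangent spaces of hypersurfaces and codimension. -/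

namespace PolyTrans

open scoped ContDiff

section Geometry

variable {E : Type*} [NormedAddCommGroup E] [NormedSpace ℂ E]

/-- Tangent vectors to a set lie in the kernel of the differential of a function vanishing on it
near the point. -/
theorem fderiv_eq_zero_of_mem_tangentVectors {S U : Set E} {x v : E} {g : E → ℂ}
    (hU : U ∈ 𝓝 x) (hg : DifferentiableAt ℂ g x) (hS : ∀ y ∈ S ∩ U, g y = 0)
    (hv : v ∈ tangentVectors S x) : fderiv ℂ g x v = 0 := by
  obtain ⟨γ, r, hr, hγ, hγS, rfl, rfl⟩ := hv
  have hball : Metric.ball (0 : ℂ) r ∈ 𝓝 (0 : ℂ) := Metric.ball_mem_nhds 0 hr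
  have hd : HasDerivAt γ (deriv γ 0) 0 := (hγ.differentiableAt hball).hasDerivAt
  have h1 : HasDerivAt (g ∘ γ) (fderiv ℂ g (γ 0) (deriv γ 0)) 0 :=
    hg.hasFDerivAt.comp_hasDerivAt 0 hd
  refine h1.unique ((hasDerivAt_const (0 : ℂ) (0 : ℂ)).congr_of_eventuallyEq ?_)
  filter_upwards [hball, hd.continuousAt hU] with t ht htU
  exact hS _ ⟨hγS t ht, htU⟩

/-- The tangent vectors of a smooth hypersurface form the kernel of the differential of its
equation. -/
theorem tangentVectors_eq_ker {S U : Set E} {x : E} {g : E → ℂ} (hU : U ∈ 𝓝 x)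
    (hg : ContDiffAt ℂ ω g x) (hx : g x = 0) (hS : S ∩ U = {y | y ∈ U ∧ g y = 0})
    (hne : fderiv ℂ g x ≠ 0) :
    ((fderiv ℂ g x).ker : Set E) = tangentVectors S x := by
  have hgd : DifferentiableAt ℂ g x := hg.differentiableAt (by simp)
  refine Set.Subset.antisymm (fun v hv => ?_) fun v hv => ?_
  swap
  · exact fderiv_eq_zero_of_mem_tangentVectors hU hgd
      (fun y hy => ((Set.ext_iff.1 hS y).1 hy).2) hv
  have hv0 : fderiv ℂ g x v = 0 := hv
  obtain ⟨u, hu⟩ : ∃ u, fderiv ℂ g x u ≠ 0 := by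
    by_contra! hcon
    exact hne (ContinuousLinearMap.ext hcon)
  -- In the plane through x spanned by v and a direction u transverse to the kernel, solve g = 0 for
  -- the u-coordinate ψ(t). Since dg(v) = 0, ψ'(0) = 0, so the curve has velocity v.
  let A : ℂ × ℂ → E := fun y => x + y.1 • v + y.2 • u
  have hA : ContDiff ℂ ω A := by fun_prop
  have hA0 : A (0, 0) = x := by simp [A]
  have hgA : ContDiffAt ℂ ω (g ∘ A) ((0 : ℂ), (0 : ℂ)) :=
    ContDiffAt.comp _ (by rwa [hA0]) hA.contDiffAt
  have hAd : HasFDerivAt A ((ContinuousLinearMap.fst ℂ ℂ ℂ).smulRight v +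
      (ContinuousLinearMap.snd ℂ ℂ ℂ).smulRight u) (0, 0) := by
    have h1 := ((ContinuousLinearMap.fst ℂ ℂ ℂ).smulRight v +
      (ContinuousLinearMap.snd ℂ ℂ ℂ).smulRight u).hasFDerivAt (x := ((0 : ℂ), (0 : ℂ)))
    refine (h1.const_add x).congr_of_eventuallyEq (Eventually.of_forall fun y => ?_)
    simp [A, add_assoc]
  have hder : fderiv ℂ (g ∘ A) ((0 : ℂ), (0 : ℂ)) (0, 1) ≠ 0 := by
    rw [((hA0.symm ▸ hgd : DifferentiableAt ℂ g (A (0, 0))).hasFDerivAt.comp _ hAd).fderiv, hA0]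
    simpa using hu
  obtain ⟨ψ, hψ, hψ0, hψz, -⟩ := exists_implicit hgA (by simp [hA0, hx]) hder
  have hψd : DifferentiableAt ℂ ψ 0 := hψ.differentiableAt (by simp)
  let γ : ℂ → E := fun t => x + t • v + ψ t • u
  have hγ0 : γ 0 = x := by simp [γ, hψ0]
  have hγd : HasDerivAt γ (v + deriv ψ 0 • u) 0 := by
    have h1 := (((hasDerivAt_id (0 : ℂ)).smul_const v).const_add x).fun_add
      (hψd.hasDerivAt.smul_const u)
    simpa [γ] using h1
  have hγg : ∀ᶠ t in 𝓝 (0 : ℂ), g (γ t) = 0 := hψz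
  have hγU : ∀ᶠ t in 𝓝 (0 : ℂ), γ t ∈ U := hγd.continuousAt (by rwa [hγ0])
  have hψ' : deriv ψ 0 = 0 := by
    have h1 : HasDerivAt (g ∘ γ) (fderiv ℂ g x (v + deriv ψ 0 • u)) 0 := by
      have h2 := (hγ0.symm ▸ hgd : DifferentiableAt ℂ g (γ 0)).hasFDerivAt.comp_hasDerivAt 0 hγd
      rwa [hγ0] at h2
    have h3 := h1.unique ((hasDerivAt_const (0 : ℂ) (0 : ℂ)).congr_of_eventuallyEq hγg)
    rw [map_add, map_smul, hv0, zero_add, smul_eq_mul] at h3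
    exact (mul_eq_zero.1 h3).resolve_right hu
  have hdiff : ∀ᶠ t in 𝓝 (0 : ℂ), DifferentiableAt ℂ γ t := by
    filter_upwards [hψ.eventually (by simp)] with t ht
    have : DifferentiableAt ℂ ψ t := ht.differentiableAt (by simp)
    fun_prop
  obtain ⟨r, hr, hball⟩ := Metric.eventually_nhds_iff_ball.1 (hγg.and (hγU.and hdiff))
  refine ⟨γ, r, hr, fun t ht => (hball t ht).2.2.differentiableWithinAt, fun t ht => ?_, hγ0, ?_⟩
  · exact ((Set.ext_iff.1 hS (γ t)).2 ⟨(hball t ht).2.1, (hball t ht).1⟩).1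
  · rw [hγd.deriv, hψ', zero_smul, add_zero]

/-- The common kernel of linearly independent linear forms has the expected codimension. -/
theorem finrank_iInf_ker_add_card [FiniteDimensional ℂ E] {ι : Type*} [Fintype ι]
    (φ : ι → E →L[ℂ] ℂ) (hφ : LinearIndependent ℂ φ) :
    Module.finrank ℂ (⨅ i, (φ i).ker : Submodule ℂ E) + Fintype.card ι = Module.finrank ℂ E := by
  let f : ι → Module.Dual ℂ E := fun i => (φ i : E →ₗ[ℂ] ℂ)
  have hf : LinearIndependent ℂ f := by
    rw [Fintype.linearIndependent_iff] at hφ ⊢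
    intro l hl
    refine hφ l (ContinuousLinearMap.ext fun v => ?_)
    simpa [f] using congrArg (fun L : Module.Dual ℂ E => L v) hl
  have h1 : (⨅ i, (φ i).ker : Submodule ℂ E) =
      (Submodule.span ℂ (Set.range f)).dualCoannihilator := by
    apply SetLike.coe_injective
    rw [Submodule.coe_dualCoannihilator_span]
    ext v
    simp [f]
  rw [h1, add_comm, ← finrank_span_eq_card hf]
  exact Subspace.finrank_add_finrank_dualCoannihilator_eq _

end Geometry

/-! ### Holomorphic markings of the critical points. -/

section Marking

variable {d : ℕ}

theorem card_roots_derivative {Q : Fin (d + 1) → ℂ} (hQ : Q ∈ PolyD d) :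
    Multiset.card (derivative (toPoly Q)).roots = d - 1 := by
  rw [IsAlgClosed.card_roots_eq_natDegree, natDegree_derivative_toPoly hQ]

theorem mem_roots_derivative (hd : 2 ≤ d) {Q : Fin (d + 1) → ℂ} (hQ : Q ∈ PolyD d) (z : ℂ) :
    z ∈ (derivative (toPoly Q)).roots.toFinset ↔ z ∈ critSet Q := by
  simp [derivative_toPoly_ne_zero hd hQ, critSet]

theorem card_toFinset_roots_derivative (hd : 2 ≤ d) {P : Fin (d + 1) → ℂ} (hP : P ∈ PolyD d)
    (hsimple : HasSimpleCritPts P) : (derivative (toPoly P)).roots.toFinset.card = d - 1 := by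
  rw [← card_roots_derivative hP, Multiset.toFinset_card_of_nodup]
  rw [Multiset.nodup_iff_count_le_one]
  intro u
  rw [count_roots]
  by_contra hcon
  have h1 := (one_lt_rootMultiplicity_iff_isRoot (derivative_toPoly_ne_zero hd hP)).1
    (not_le.1 hcon)
  exact hsimple u h1.1 h1.2

/-- Distinct roots of the derivative, in the expected number, are all of the critical points. -/
theorem range_eq_critSet (hd : 2 ≤ d) {Q : Fin (d + 1) → ℂ} (hQ : Q ∈ PolyD d)
    (c : Fin (d - 1) → ℂ) (hinj : Function.Injective c) (hc : ∀ i, c i ∈ critSet Q) :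
    Set.range c = critSet Q := by
  classical
  have h1 : Finset.univ.image c = (derivative (toPoly Q)).roots.toFinset := by
    refine Finset.eq_of_subset_of_card_le (fun z hz => ?_) ?_
    · obtain ⟨i, -, rfl⟩ := Finset.mem_image.1 hz
      exact (mem_roots_derivative hd hQ _).2 (hc i)
    · rw [Finset.card_image_of_injective _ hinj, Finset.card_univ, Fintype.card_fin,
        ← card_roots_derivative hQ]
      exact Multiset.toFinset_card_le _
  ext z
  rw [← mem_roots_derivative hd hQ, ← h1]
  simp

/-- Simplicity gives exactly d - 1 critical points, so d - 1 labels exhausting them cannot repeat.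
-/
theorem injective_of_range_eq (hd : 2 ≤ d) {P : Fin (d + 1) → ℂ} (hP : P ∈ PolyD d)
    (hsimple : HasSimpleCritPts P) (c : Fin (d - 1) → ℂ) (hc : Set.range c = critSet P) :
    Function.Injective c := by
  classical
  have h1 : Finset.univ.image c = (derivative (toPoly P)).roots.toFinset := by
    ext z
    rw [mem_roots_derivative hd hP, ← hc]
    simp
  have h2 : (Finset.univ.image c).card = (Finset.univ : Finset (Fin (d - 1))).card := by
    rw [h1, card_toFinset_roots_derivative hd hP hsimple, Finset.card_univ, Fintype.card_fin]
  rw [Finset.card_image_iff] at h2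
  exact Set.injOn_univ.1 (by simpa using h2)

/-- A simple critical point has a unique local continuation, which is holomorphic. -/
theorem exists_crit_continuation {P : Fin (d + 1) → ℂ} {z : ℂ} (hz : z ∈ critSet P)
    (hz2 : (derivative (derivative (toPoly P))).eval z ≠ 0) :
    ∃ ψ : (Fin (d + 1) → ℂ) → ℂ, ContDiffAt ℂ ω ψ P ∧ ψ P = z ∧
      (∀ᶠ Q in 𝓝 P, ψ Q ∈ critSet Q) ∧
      ∀ᶠ y in 𝓝 (P, z), y.2 ∈ critSet y.1 → ψ y.1 = y.2 := by
  have hsm := (contDiff_eval_derivative (d := d)).contDiffAt (x := (P, z))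
  refine exists_implicit hsm hz ?_
  have h1 := (hsm.differentiableAt (by simp)).hasFDerivAt
  have h2 : HasDerivAt (fun s : ℂ => (P, s)) ((0 : Fin (d + 1) → ℂ), (1 : ℂ)) z :=
    (hasDerivAt_const z P).prodMk (hasDerivAt_id z)
  have h3 := h1.comp_hasDerivAt z h2
  rw [h3.unique ((derivative (toPoly P)).hasDerivAt z)]
  exact hz2

theorem exists_isCritMarking (hd : 2 ≤ d) {P : Fin (d + 1) → ℂ} (hP : P ∈ PolyD d)
    (hsimple : HasSimpleCritPts P) :
    ∃ (V : Set (Fin (d + 1) → ℂ)) (c : Fin (d - 1) → (Fin (d + 1) → ℂ) → ℂ),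
      IsCritMarking P V c := by
  classical
  let e := (derivative (toPoly P)).roots.toFinset.equivFinOfCardEq
    (card_toFinset_roots_derivative hd hP hsimple)
  let z : Fin (d - 1) → ℂ := fun i => (e.symm i : ℂ)
  have hz : ∀ i, z i ∈ critSet P := fun i => (mem_roots_derivative hd hP _).1 (e.symm i).2
  have hzi : Function.Injective z := Subtype.val_injective.comp e.symm.injective
  choose ψ hψ hψ0 hψc _ using fun i => exists_crit_continuation (hz i) (hsimple _ (hz i))
  -- The continuations stay distinct near `P`, so by counting they exhaust the critical points.
  have hne : ∀ᶠ Q in 𝓝 P, ∀ i j, i ≠ j → ψ i Q ≠ ψ j Q := by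
    refine eventually_all.2 fun i => eventually_all.2 fun j => ?_
    by_cases hij : i = j
    · exact Eventually.of_forall fun Q h => (h hij).elim
    have := ((hψ i).continuousAt.sub (hψ j).continuousAt).eventually_ne (y := 0)
      (by rw [Pi.sub_apply, hψ0, hψ0]; exact sub_ne_zero.2 (hzi.ne hij))
    filter_upwards [this] with Q hQ _ using sub_ne_zero.1 hQ
  have hall : ∀ᶠ Q in 𝓝 P, Q ∈ PolyD d ∧ (∀ i, DifferentiableAt ℂ (ψ i) Q) ∧
      (∀ i, ψ i Q ∈ critSet Q) ∧ ∀ i j, i ≠ j → ψ i Q ≠ ψ j Q := by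
    refine (isOpen_polyD.eventually_mem hP).and ((eventually_all.2 fun i => ?_).and
      ((eventually_all.2 hψc).and hne))
    filter_upwards [(hψ i).eventually (by simp)] with Q hQ using hQ.differentiableAt (by simp)
  obtain ⟨V, hV, hVo, hPV⟩ := eventually_nhds_iff.1 hall
  exact ⟨V, ψ, hVo, hPV, fun Q hQ => (hV Q hQ).1,
    fun i Q hQ => ((hV Q hQ).2.1 i).differentiableWithinAt,
    fun Q hQ => range_eq_critSet hd (hV Q hQ).1 _
      (fun i j hij => not_imp_comm.1 ((hV Q hQ).2.2.2 i j) (not_not.2 hij)) (hV Q hQ).2.2.1⟩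

variable {P : Fin (d + 1) → ℂ} {V : Set (Fin (d + 1) → ℂ)}
  {c : Fin (d - 1) → (Fin (d + 1) → ℂ) → ℂ}

theorem IsCritMarking.mem_critSet (h : IsCritMarking P V c) {Q : Fin (d + 1) → ℂ} (hQ : Q ∈ V)
    (i : Fin (d - 1)) : c i Q ∈ critSet Q :=
  h.range_eq Q hQ ▸ Set.mem_range_self i

theorem IsCritMarking.mem_nhds (h : IsCritMarking P V c) : V ∈ 𝓝 P :=
  h.isOpen.mem_nhds h.mem

theorem IsCritMarking.differentiableAt (h : IsCritMarking P V c) (i : Fin (d - 1)) :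
    DifferentiableAt ℂ (c i) P :=
  (h.holo i).differentiableAt h.mem_nhds

theorem IsCritMarking.eventually_mem_critSet (h : IsCritMarking P V c) (i : Fin (d - 1)) :
    ∀ᶠ Q in 𝓝 P, c i Q ∈ critSet Q := by
  filter_upwards [h.mem_nhds] with Q hQ using h.mem_critSet hQ i

/-- By uniqueness of the continuation of a simple critical point, the given marking agrees near `P`
with the analytic implicit function. -/
theorem IsCritMarking.contDiffAt (h : IsCritMarking P V c) (hsimple : HasSimpleCritPts P)
    (i : Fin (d - 1)) : ContDiffAt ℂ ω (c i) P := by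
  have hmem := h.mem_critSet h.mem i
  obtain ⟨ψ, hψ, -, -, huniq⟩ := exists_crit_continuation hmem (hsimple _ hmem)
  refine hψ.congr_of_eventuallyEq ?_
  have ht : Tendsto (fun Q => (Q, c i Q)) (𝓝 P) (𝓝 (P, c i P)) :=
    (continuousAt_id.prodMk (h.differentiableAt i).continuousAt).tendsto
  filter_upwards [ht.eventually huniq, h.eventually_mem_critSet i] with Q hQ hQc
  exact (hQ hQc).symm

theorem IsCritMarking.contDiffAt_iterate_sub (h : IsCritMarking P V c)
    (hsimple : HasSimpleCritPts P) (i : Fin (d - 1)) (m : ℕ) :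
    ContDiffAt ℂ ω (fun Q => (dyn Q)^[m] (c i Q) - c i Q) P :=
  (contDiffAt_iterate_dyn (h.contDiffAt hsimple i) m).sub (h.contDiffAt hsimple i)

theorem IsCritMarking.fderiv_iterate_sub (h : IsCritMarking P V c) (hsimple : HasSimpleCritPts P)
    (i : Fin (d - 1)) {m : ℕ} (hm : 1 ≤ m) (v : Fin (d + 1) → ℂ) :
    fderiv ℂ (fun Q => (dyn Q)^[m] (c i Q) - c i Q) P v =
      critVariation (toPoly P) (c i P) m (fun z => (toPoly v).eval z)
        ((derivative (toPoly v)).eval (c i P)) :=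
  PolyTrans.fderiv_iterate_sub (h.differentiableAt i) (h.eventually_mem_critSet i)
    (hsimple _ (h.mem_critSet h.mem i)) hm v

/-- The differentials of the equations of the hypersurfaces are linearly independent. -/
theorem IsCritMarking.linearIndependent (hd : 2 ≤ d) (hP : P ∈ PolyD d) (h : IsCritMarking P V c)
    (hsimple : HasSimpleCritPts P) (m : Fin (d - 1) → ℕ) (hm : ∀ i, 1 ≤ m i)
    (hper : ∀ i, (dyn P)^[m i] (c i P) = c i P) :
    LinearIndependent ℂ (fun i : Fin (d - 1) =>
      fderiv ℂ (fun Q : Fin (d + 1) → ℂ => (dyn Q)^[m i] (c i Q) - c i Q) P) := by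
  rw [Fintype.linearIndependent_iff]
  intro l hl
  have hmem := h.mem_critSet h.mem
  refine eq_zero_of_critVariation (toPoly P) (by rwa [natDegree_toPoly hP]) (fun i => c i P)
    (injective_of_range_eq hd hP hsimple _ (h.range_eq P h.mem)) m l hmem
    (fun i => hsimple _ (hmem i)) hm hper fun g hg => ?_
  rw [natDegree_toPoly hP] at hg
  have h1 := congrArg (fun L => L (fun i : Fin (d + 1) => g.coeff i)) hl
  simp only [sum_apply, smul_apply, smul_eq_mul, zero_apply] at h1
  rw [← h1]
  refine Finset.sum_congr rfl fun i _ => ?_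
  rw [h.fderiv_iterate_sub hsimple i (hm i), toPoly_coeff g hg]

end Marking

/-- Following a critical point along several turns of its cycle gives the same variation. -/
theorem critVariation_add_period (p : ℂ[X]) (c : ℂ) (r m : ℕ) (hm : 1 ≤ m)
    (hc : (derivative p).eval c = 0) (hr : (fun z => p.eval z)^[r] c = c) (f : ℂ → ℂ) (s : ℂ) :
    critVariation p c (r + m) f s = critVariation p c m f s := by
  simp only [critVariation]
  rw [Finset.sum_range_add, Finset.sum_eq_zero, zero_add]
  · congr 1
    refine Finset.sum_congr rfl fun k _ => ?_
    have hit : ∀ j, (fun z => p.eval z)^[r + j] c = (fun z => p.eval z)^[j] c := fun j => by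
      rw [add_comm, Function.iterate_add_apply, hr]
    rw [hit]
    congr 1
    rw [orbitWeight, orbitWeight, add_assoc, add_comm r (k + 1), add_comm r m,
      ← Finset.prod_Ico_add]
    exact Finset.prod_congr rfl fun j _ => by rw [hit]
  · intro k hk
    have hk := Finset.mem_range.1 hk
    -- For k < r the weight contains the factor with index r, which is p'(c) = 0 because the orbit
    -- returns to c at time r.
    rw [orbitWeight, Finset.prod_eq_zero (i := r) (by simp; omega) (by rw [hr, hc]), zero_mul]

/-! ### The affine conjugacy orbit and its tangent vectors. -/

section Orbit

variable {d : ℕ}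

/-- A common period of the critical points of `P` is one for all affine conjugates of `P`. -/
theorem iterate_eq_of_mem_affineOrbit {P Q : Fin (d + 1) → ℂ} {N : ℕ}
    (hN : ∀ z ∈ critSet P, (dyn P)^[N] z = z) (hQ : Q ∈ affineOrbit P) {z : ℂ}
    (hz : z ∈ critSet Q) : (dyn Q)^[N] z = z := by
  obtain ⟨-, α, β, hα, hconj⟩ := hQ
  have hiter : ∀ n w, α * (dyn Q)^[n] w + β = (dyn P)^[n] (α * w + β) := by
    intro n
    induction n with
    | zero => intro w; rfl
    | succ n ih => intro w; rw [Function.iterate_succ_apply, ih, hconj, Function.iterate_succ_apply]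
  have hcrit : α * z + β ∈ critSet P := by
    have h1 : HasDerivAt (fun w => α * dyn Q w + β) (α * (derivative (toPoly Q)).eval z) z :=
      (((toPoly Q).hasDerivAt z).const_mul α).add_const β
    have h2 : HasDerivAt (fun w => α * w + β) α z := by
      simpa using ((hasDerivAt_id z).const_mul α).add_const β
    have h3 : HasDerivAt (fun w => dyn P (α * w + β))
        ((derivative (toPoly P)).eval (α * z + β) * α) z :=
      HasDerivAt.comp (h₂ := dyn P) z ((toPoly P).hasDerivAt (α * z + β)) h2
    have h4 : (fun w => α * dyn Q w + β) = fun w => dyn P (α * w + β) := funext hconj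
    rw [h4] at h1
    have h5 := h1.unique h3
    rw [show (derivative (toPoly Q)).eval z = 0 from hz, mul_zero] at h5
    exact (mul_eq_zero.1 h5.symm).resolve_right hα
  have h6 := hiter N z
  rw [hN _ hcrit] at h6
  exact mul_left_cancel₀ hα (add_right_cancel h6)

theorem sum_binomial_mul_pow {i : Fin (d + 1)} (x y z : ℂ) :
    ∑ j : Fin (d + 1), ((i : ℕ).choose j : ℂ) * x ^ (j : ℕ) * y ^ ((i : ℕ) - j) * z ^ (j : ℕ) =
      (x * z + y) ^ (i : ℕ) := by
  rw [Fin.sum_univ_eq_sum_range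
    (fun j => ((i : ℕ).choose j : ℂ) * x ^ j * y ^ ((i : ℕ) - j) * z ^ j) (d + 1), add_pow]
  symm
  refine Finset.sum_subset_zero_on_sdiff (by simpa using Nat.succ_le_of_lt i.2) ?_ ?_
  · intro j hj
    simp only [Finset.mem_sdiff, Finset.mem_range] at hj
    -- For j > i the binomial coefficient vanishes, so the truncated exponent i - j is harmless.
    rw [Nat.choose_eq_zero_of_lt (by omega)]
    simp
  · intro j _
    ring

/-- Conjugation by the affine maps `z ↦ (1 + a t) z + b t` gives a curve in the orbit of `P`. -/
theorem exists_mem_tangentVectors_affineOrbit {P : Fin (d + 1) → ℂ} (hP : P ∈ PolyD d) (a b : ℂ) :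
    ∃ v ∈ tangentVectors (affineOrbit P) P, ∀ z, (toPoly v).eval z =
      (derivative (toPoly P)).eval z * (a * z + b) - b - a * (toPoly P).eval z := by
  -- Binomial expansion of the coefficients of φ⁻¹ ∘ P ∘ φ for φ(z) = (1 + at)z + bt.
  let γ : ℂ → Fin (d + 1) → ℂ := fun t j => ((∑ i : Fin (d + 1), P i *
    (((i : ℕ).choose j : ℂ) * (1 + a * t) ^ (j : ℕ) * (b * t) ^ ((i : ℕ) - j))) -
      b * t * (if j = 0 then 1 else 0)) / (1 + a * t)
  have hdyn : ∀ t z, dyn (γ t) z =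
      (dyn P ((1 + a * t) * z + b * t) - b * t) / (1 + a * t) := by
    intro t z
    simp only [dyn, eval_toPoly, γ, eval_pow, eval_X]
    simp_rw [← sum_binomial_mul_pow, div_mul_eq_mul_div, sub_mul]
    rw [← Finset.sum_div, Finset.sum_sub_distrib]
    congr 2
    · simp_rw [Finset.sum_mul, Finset.mul_sum]
      rw [Finset.sum_comm]
      exact Finset.sum_congr rfl fun i _ => Finset.sum_congr rfl fun j _ => by ring
    · simp [mul_ite, ite_mul]
  have hγ0 : γ 0 = P := ext_of_dyn_eq fun z => by rw [hdyn]; simp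
  have hne : ∀ᶠ t : ℂ in 𝓝 0, 1 + a * t ≠ 0 := by
    have : ContinuousAt (fun t : ℂ => 1 + a * t) 0 := by fun_prop
    exact this.eventually_ne (by simp)
  have hγd : ∀ t, 1 + a * t ≠ 0 → DifferentiableAt ℂ γ t := by
    intro t ht
    refine differentiableAt_pi.2 fun j => ?_
    exact DifferentiableAt.div (by fun_prop) (by fun_prop) ht
  have hγd0 : DifferentiableAt ℂ γ 0 := hγd 0 (by simp)
  have hmem : ∀ᶠ t in 𝓝 (0 : ℂ), γ t ∈ PolyD d :=
    hγd0.continuousAt (isOpen_polyD.mem_nhds (by rwa [hγ0]))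
  obtain ⟨r, hr, hball⟩ := Metric.eventually_nhds_iff_ball.1 (hne.and hmem)
  refine ⟨deriv γ 0, ⟨γ, r, hr,
    fun t ht => (hγd t (hball t ht).1).differentiableWithinAt,
    fun t ht => ⟨(hball t ht).2, 1 + a * t, b * t, (hball t ht).1, fun z => ?_⟩, hγ0, rfl⟩,
    fun z => ?_⟩
  · rw [hdyn, mul_div_cancel₀ _ (hball t ht).1, sub_add_cancel]
  · have h1 : HasDerivAt (fun t => dyn (γ t) z) ((toPoly (deriv γ 0)).eval z) 0 := by
      have h2 := (evalCLM d z).hasFDerivAt.comp_hasDerivAt 0 hγd0.hasDerivAt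
      rw [evalCLM_apply] at h2
      exact h2.congr_of_eventuallyEq (Eventually.of_forall fun t => (evalCLM_apply z (γ t)).symm)
    have h3 : HasDerivAt (fun t : ℂ => 1 + a * t) a 0 := by
      simpa using ((hasDerivAt_id (0 : ℂ)).const_mul a).const_add 1
    have h4 : HasDerivAt (fun t : ℂ => b * t) b 0 := by
      simpa using (hasDerivAt_id (0 : ℂ)).const_mul b
    have h5 : HasDerivAt (fun t : ℂ => (1 + a * t) * z + b * t) (a * z + b) 0 :=
      (h3.mul_const z).add h4
    have h6 : HasDerivAt (fun t : ℂ => dyn P ((1 + a * t) * z + b * t))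
        ((derivative (toPoly P)).eval ((1 + a * 0) * z + b * 0) * (a * z + b)) 0 :=
      ((toPoly P).hasDerivAt _).comp (0 : ℂ) h5
    have h7 := (h6.sub h4).div h3 (by simp)
    have h8 : (fun t => dyn (γ t) z) =
        fun t => (dyn P ((1 + a * t) * z + b * t) - b * t) / (1 + a * t) := funext (hdyn · z)
    rw [h8] at h1
    rw [h1.unique h7]
    simp [dyn]
    ring

/-- A linear space of dimension two that contains the tangent vectors of the affine orbit consists
of such tangent vectors. -/
theorem eq_tangentVectors_affineOrbit (hd : 2 ≤ d) {P : Fin (d + 1) → ℂ} (hP : P ∈ PolyD d)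
    (K : Submodule ℂ (Fin (d + 1) → ℂ)) (hK : Module.finrank ℂ K = 2)
    (hsub : tangentVectors (affineOrbit P) P ⊆ K) :
    (K : Set (Fin (d + 1) → ℂ)) = tangentVectors (affineOrbit P) P := by
  refine Set.Subset.antisymm (fun v hv => ?_) hsub
  obtain ⟨v₁, hv₁, he₁⟩ := exists_mem_tangentVectors_affineOrbit hP 1 0
  obtain ⟨v₂, hv₂, he₂⟩ := exists_mem_tangentVectors_affineOrbit hP 0 1
  have hcomb : ∀ a b z, (toPoly (a • v₁ + b • v₂)).eval z =
      (derivative (toPoly P)).eval z * (a * z + b) - b - a * (toPoly P).eval z := by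
    intro a b z
    rw [← evalCLM_apply, map_add, map_smul, map_smul, evalCLM_apply, evalCLM_apply, he₁, he₂]
    simp only [smul_eq_mul]
    ring
  have hlast : (toPoly P).coeff d ≠ 0 := by
    have := coeff_toPoly P (Fin.last d)
    rw [Fin.val_last] at this
    rw [this]
    exact hP
  have hind : LinearIndependent ℂ ![(⟨v₁, hsub hv₁⟩ : K), ⟨v₂, hsub hv₂⟩] := by
    rw [LinearIndependent.pair_iff]
    intro a b hab
    have hab' : a • v₁ + b • v₂ = 0 := congrArg Subtype.val hab
    have hpoly : derivative (toPoly P) * (C a * X + C b) - C b - C a * toPoly P = 0 := by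
      refine Polynomial.funext fun z => ?_
      have := hcomb a b z
      rw [hab', ← evalCLM_apply, map_zero] at this
      simpa using this.symm
    obtain ⟨n, rfl⟩ : ∃ n, d = n + 2 := ⟨d - 2, by omega⟩
    have hbig : (toPoly P).coeff (n + 3) = 0 :=
      coeff_eq_zero_of_natDegree_lt ((natDegree_toPoly_le P).trans_lt (by omega))
    have hco : ∀ k, (derivative (toPoly P)).coeff k * a + (derivative (toPoly P)).coeff (k + 1) * b
        - (C b).coeff (k + 1) - a * (toPoly P).coeff (k + 1) = 0 := by
      intro k
      have := congrArg (fun g => coeff g (k + 1)) hpoly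
      simpa [mul_add, ← mul_assoc, coeff_mul_X, mul_right_comm] using this
    -- The coefficient of z^d is (d-1) a times the leading coefficient of `P`, and d ≥ 2. Once a =
    -- 0, the coefficient of z^{d-1} gives b = 0.
    have ha : a = 0 := by
      have := hco (n + 1)
      simp only [coeff_derivative, coeff_C_succ, hbig, zero_mul, sub_zero, add_zero] at this
      have h2 : a * (((n : ℂ) + 1) * (toPoly P).coeff (n + 2)) = 0 := by
        push_cast at this
        linear_combination this
      rcases mul_eq_zero.1 h2 with h3 | h3
      · exact h3
      · exact absurd h3 (mul_ne_zero (Nat.cast_add_one_ne_zero n) hlast)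
    refine ⟨ha, ?_⟩
    subst ha
    have := hco n
    simp only [coeff_derivative, coeff_C_succ, mul_zero, zero_mul, sub_zero, zero_add] at this
    rcases mul_eq_zero.1 this with h3 | h3
    · refine absurd h3 (mul_ne_zero hlast ?_)
      exact Nat.cast_add_one_ne_zero (n + 1)
    · exact h3
  have hspan := hind.span_eq_top_of_card_eq_finrank (by simp [hK])
  have hvs : (⟨v, hv⟩ : K) ∈ Submodule.span ℂ (Set.range
      ![(⟨v₁, hsub hv₁⟩ : K), ⟨v₂, hsub hv₂⟩]) := hspan ▸ Submodule.mem_top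
  rw [Matrix.range_cons, Matrix.range_cons, Matrix.range_empty, Set.union_empty,
    Set.singleton_union, Submodule.mem_span_pair] at hvs
  obtain ⟨a, b, hab⟩ := hvs
  have hab' : a • v₁ + b • v₂ = v := congrArg Subtype.val hab
  -- The set of velocities is not known to be linear beforehand, so the combination is realised
  -- directly by the curve with parameters a and b.
  obtain ⟨w, hw, hwe⟩ := exists_mem_tangentVectors_affineOrbit hP a b
  have : w = v := ext_of_dyn_eq fun z => by
    rw [← hab']
    simp only [dyn]
    rw [hwe, hcomb]
  rwa [← this]

end Orbit

end PolyTrans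

/-! ### Assembly of the theorem. -/

theorem mainTheorem7 (d : ℕ) (hd : 2 ≤ d) (P : Fin (d + 1) → ℂ) (hP : P ∈ PolyTrans.PolyD d)
    (hhyp : PolyTrans.IsHyperbolic P) (hpcf : PolyTrans.IsPostcriticallyFinite P)
    (hsimple : PolyTrans.HasSimpleCritPts P) (hper : PolyTrans.HasPeriodicCritPts P) :
    (∃ (V : Set (Fin (d + 1) → ℂ)) (c : Fin (d - 1) → (Fin (d + 1) → ℂ) → ℂ),
      PolyTrans.IsCritMarking P V c) ∧
    ∀ (V : Set (Fin (d + 1) → ℂ)) (c : Fin (d - 1) → (Fin (d + 1) → ℂ) → ℂ),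
      PolyTrans.IsCritMarking P V c →
      ∀ m : Fin (d - 1) → ℕ, (∀ i, 1 ≤ m i) →
        (∀ i, (PolyTrans.dyn P)^[m i] (c i P) = c i P) →
        (((fderiv ℂ (PolyTrans.critMap c) P - fderiv ℂ (PolyTrans.iterMap c m) P).ker :
            Submodule ℂ (Fin (d + 1) → ℂ)) : Set (Fin (d + 1) → ℂ)) =
          PolyTrans.tangentVectors (PolyTrans.affineOrbit P) P ∧
        (∀ i, PolyTrans.IsSmoothHypersurfaceAt (PolyTrans.perHypersurface V c m i) P) ∧
        PolyTrans.IsTransverseAt (PolyTrans.perHypersurface V c m) P ∧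
        LinearIndependent ℂ (fun i : Fin (d - 1) =>
          fderiv ℂ (fun Q : Fin (d + 1) → ℂ => (PolyTrans.dyn Q)^[m i] (c i Q) - c i Q) P) := by
  refine ⟨PolyTrans.exists_isCritMarking hd hP hsimple, fun V c h m hm hperm => ?_⟩
  have hlin := h.linearIndependent hd hP hsimple m hm hperm
  set g : Fin (d - 1) → (Fin (d + 1) → ℂ) → ℂ :=
    fun i Q => (PolyTrans.dyn Q)^[m i] (c i Q) - c i Q with hg
  have hlin' : LinearIndependent ℂ (fun i => fderiv ℂ (g i) P) := hlin
  have hgP : ∀ i, g i P = 0 := fun i => sub_eq_zero.2 (hperm i)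
  have hne : ∀ i, fderiv ℂ (g i) P ≠ 0 := fun i => hlin'.ne_zero i
  have hS : ∀ i, PolyTrans.perHypersurface V c m i ∩ V = {y | y ∈ V ∧ g i y = 0} := by
    intro i
    ext Q
    simp only [PolyTrans.perHypersurface, hg, sub_eq_zero, Set.mem_inter_iff, Set.mem_ofPred_eq]
    tauto
  have hfin := PolyTrans.finrank_iInf_ker_add_card _ hlin'
  have hker : (fderiv ℂ (PolyTrans.critMap c) P - fderiv ℂ (PolyTrans.iterMap c m) P).ker =
      ⨅ i, (fderiv ℂ (g i) P).ker := by
    ext v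
    have h1 : fderiv ℂ (PolyTrans.critMap c) P =
        ContinuousLinearMap.pi fun i => fderiv ℂ (c i) P :=
      fderiv_pi h.differentiableAt
    have h2 : fderiv ℂ (PolyTrans.iterMap c m) P =
        ContinuousLinearMap.pi fun i => fderiv ℂ (fun Q => (PolyTrans.dyn Q)^[m i] (c i Q)) P :=
      fderiv_pi fun i => PolyTrans.differentiableAt_iterate_dyn (h.differentiableAt i) (m i)
    have h3 : ∀ i, fderiv ℂ (g i) P = fderiv ℂ (fun Q => (PolyTrans.dyn Q)^[m i] (c i Q)) P -
        fderiv ℂ (c i) P := fun i =>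
      fderiv_fun_sub (PolyTrans.differentiableAt_iterate_dyn (h.differentiableAt i) (m i))
        (h.differentiableAt i)
    rw [h1, h2]
    simp only [Submodule.mem_iInf, LinearMap.mem_ker, h3]
    constructor
    · intro hv i
      have := congrFun hv i
      exact sub_eq_zero.2 (sub_eq_zero.1 this).symm
    · intro hv
      funext i
      exact sub_eq_zero.2 (sub_eq_zero.1 (hv i)).symm
  refine ⟨?_, fun i => ⟨⟨h.mem, hperm i⟩, V, g i, h.isOpen, h.mem, fun Q hQ => ?_, hne i, hS i⟩,
    ⟨fun i => (fderiv ℂ (g i) P).ker, fun i =>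
      PolyTrans.tangentVectors_eq_ker h.mem_nhds (h.contDiffAt_iterate_sub hsimple i (m i)) (hgP i) (hS i) (hne i), hfin⟩, hlin⟩
  · rw [hker]
    refine PolyTrans.eq_tangentVectors_affineOrbit hd hP _ ?_ fun v hv => ?_
    · rw [Fintype.card_fin, Module.finrank_fin_fun] at hfin
      omega
    rw [SetLike.mem_coe, Submodule.mem_iInf]
    intro i
    rw [LinearMap.mem_ker]
    -- A conjugacy sends c_i(Q) to some critical point of `P`, and a common period N spares
    -- identifying which one. The variation along N steps equals the one along m_i steps.
    set N := ∏ j, m j with hN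
    have hcN : ∀ z ∈ PolyTrans.critSet P, (PolyTrans.dyn P)^[N] z = z := by
      intro z hz
      rw [← h.range_eq P h.mem] at hz
      obtain ⟨j, rfl⟩ := hz
      exact Function.IsPeriodicPt.trans_dvd (hperm j) (Finset.dvd_prod_of_mem m (Finset.mem_univ j))
    have hNpos : 0 < N := Finset.prod_pos fun j _ => hm j
    obtain ⟨r, hr⟩ : ∃ r, N = r + m i :=
      ⟨N - m i, (Nat.sub_add_cancel (Nat.le_of_dvd hNpos
        (Finset.dvd_prod_of_mem m (Finset.mem_univ i)))).symm⟩
    have hrper : (PolyTrans.dyn P)^[r] (c i P) = c i P := by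
      have := hcN _ (h.mem_critSet h.mem i)
      rwa [hr, Function.iterate_add_apply, hperm i] at this
    have h1 := PolyTrans.fderiv_eq_zero_of_mem_tangentVectors
      (g := fun Q => (PolyTrans.dyn Q)^[N] (c i Q) - c i Q) h.mem_nhds
      ((PolyTrans.differentiableAt_iterate_dyn (h.differentiableAt i) N).sub (h.differentiableAt i))
      (fun Q hQ => sub_eq_zero.2 (PolyTrans.iterate_eq_of_mem_affineOrbit hcN hQ.1
        (h.mem_critSet hQ.2 i))) hv
    rw [h.fderiv_iterate_sub hsimple i hNpos, hr,
      PolyTrans.critVariation_add_period _ _ r (m i) (hm i) (h.mem_critSet h.mem i) hrper,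
      ← h.fderiv_iterate_sub hsimple i (hm i)] at h1
    exact h1
  · have hci := (h.holo i).differentiableAt (h.isOpen.mem_nhds hQ)
    exact ((PolyTrans.differentiableAt_iterate_dyn hci (m i)).sub hci).differentiableWithinAt
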